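/- Let $\mathbb{G}$ be a graded Lie group, i.e. a connected, simply connected Lie group whose Lie algebra has a grading $\mathfrak g=\bigoplus_{i\ge1}\mathfrak g_i$, $[\mathfrak g_i,\mathfrak g_j]\subset\mathfrak g_{i+j}$. Write $\mathbb G=\mathbb R^n$ in exponential coordinates with respect to a basis $X_1,\dots,X_n$ of $\mathfrak g$ with $X_j\in\mathfrak g_{\nu_j}$, so that the dilations $D_r(x)=(r^{\nu_1}x_1,\dots,r^{\nu_n}x_n)$, $r>0$, are automorphisms of $\mathbb G$ and the bi-invariant Haar measure is Lebesgue measure. Let $Q=\nu_1+\dots+\nu_n$, and let $f*g(x)=\int_{\mathbb G}f(y)\,g(y^{-1}x)\,dy$. Let $\mathcal R=\sum_{[\alpha]=\nu}c_\alpha X_1^{\alpha_1}\cdots X_n^{\alpha_n}$, where $[\alpha]=\sum_j\nu_j\alpha_j$, be a positive Rockland operator of homogeneous degree $\nu>0$: a left-invariant differential operator such that $\langle\mathcal Rf,f\rangle_{L^2}\ge0$ for all $f\in C_c^\infty(\mathbb G)$, and such that $\pi(\mathcal R)$ is injective on the smooth vectors of $\pi$ for every nontrivial irreducible unitary representation $\pi$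 of $\mathbb G$. Then $\mathcal R$, defined on $C_c^\infty(\mathbb G)$, has a non-negative self-adjoint extension on $L^2(\mathbb G)$ (it is known to be the only self-adjoint extension); any such extension is again written $\mathcal R$, and the following holds for it. Let $T>0$. For a real bounded continuous potential $W$ and $g\in L^2(\mathbb G)$, a classical solution on $[0,T]$ of $$u_t+\mathcal Ru+Wu=0,\qquad u(0)=g,\tag{1}$$ is a $u\in C([0,T];L^2(\mathbb G))$ with $u(0)=g$ such that for every $t\in(0,T]$ one has $u(t)\in\mathrm{Dom}(\mathcal R)$, $u$ is differentiable at $t$ as an $L^2(\mathbb G)$-valued function on $[0,T]$ (one-sidedly if $t=T$), and $u_t(t)=-\mathcal Ru(t)-Wu(t)$. Let $V\in C_0(\mathbb G)$ be real-valued (continuous and vanishing at infinity) and let $u_0\in L^2(\mathbb G)$. Let $\psi,\varphi$ be real-valued smooth compactly supported functions with $\int\psi\,dx=\int\varphi\,dx=1$, let $\omega,\eta:(0,1]\to(0,\infty)$ tend to $0$ as $\varepsilon\to0$, and for $\varepsilon\in(0,1]$ put $$\psi_\varepsilon(x)=\omega(\varepsilon)^{-Q}\psi(D_{\omega(\varepsilon)^{-1}}x),\quad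 \varphi_\varepsilon(x)=\eta(\varepsilon)^{-Q}\varphi(D_{\eta(\varepsilon)^{-1}}x),\quad V_\varepsilon=V*\psi_\varepsilon,\quad u_{0,\varepsilon}=u_0*\varphi_\varepsilon .$$ Then problem (1) with $W=V$, $g=u_0$ has a unique classical solution $u$, and $\|u(t)\|_{L^2}\le e^{t\|V\|_{L^\infty}}\|u_0\|_{L^2}$ for all $t\in[0,T]$; for every $\varepsilon\in(0,1]$, problem (1) with $W=V_\varepsilon$, $g=u_{0,\varepsilon}$ has a unique classical solution $u_\varepsilon$; and $$\sup_{t\in[0,T]}\|u_\varepsilon(t)-u(t)\|_{L^2(\mathbb G)}\longrightarrow0\qquad(\varepsilon\to0).$$ -/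

import Mathlib

open MeasureTheory Filter Topology Set
open scoped ContDiff ZeroAtInfty

/-- A graded Lie group of dimension `n`, written in exponential coordinates with respect to a basis
`e_1, …, e_n` of its Lie algebra `𝔤 = ⊕_{i ≥ 1} 𝔤_i` that is adapted to the grading, with
`e_j ∈ 𝔤_{weight j}`.  The exponential map of a connected, simply connected graded group is a
global diffeomorphism, so the group is `ℝⁿ` with a smooth group law, and
* `mul_smul_smul` says that the coordinates are exponential: the one-parameter subgroups are the
  lines `t ↦ t x`; hence `0` is the neutral element and `-x` is the inverse of `x`;
* `mul_dilation` says that the canonical dilations `D_r (x) = (r^{ν_1} x_1, …, r^{ν_n} x_n)` are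
  automorphisms; on the Lie algebra this is `[𝔤_i, 𝔤_j] ⊆ 𝔤_{i+j}`. -/
structure GradedLieGroup (n : ℕ) where
  weight : Fin n → ℕ
  weight_pos : ∀ j, 0 < weight j
  mul : (Fin n → ℝ) → (Fin n → ℝ) → (Fin n → ℝ)
  contDiff_mul : ContDiff ℝ ∞ (fun p : (Fin n → ℝ) × (Fin n → ℝ) => mul p.1 p.2)
  mul_assoc : ∀ x y z, mul (mul x y) z = mul x (mul y z)
  mul_smul_smul : ∀ (s t : ℝ) (x : Fin n → ℝ), mul (s • x) (t • x) = (s + t) • x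
  mul_dilation : ∀ (r : ℝ), 0 < r → ∀ x y : Fin n → ℝ,
    (fun j => r ^ weight j * mul x y j)
      = mul (fun j => r ^ weight j * x j) (fun j => r ^ weight j * y j)

/-- The Hilbert space `L²(G)`, complex valued; in exponential coordinates the bi-invariant Haar
measure is Lebesgue measure. -/
abbrev GradedLieGroup.L2 (n : ℕ) : Type := Lp ℂ 2 (volume : Measure (Fin n → ℝ))

namespace GradedLieGroup

variable {n : ℕ}

/-- The dilation `D_r`. -/
def dilation (G : GradedLieGroup n) (r : ℝ) (x : Fin n → ℝ) : Fin n → ℝ :=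
  fun j => r ^ G.weight j * x j

/-- The homogeneous dimension `Q = ν_1 + ⋯ + ν_n`. -/
def homDim (G : GradedLieGroup n) : ℕ := ∑ j, G.weight j

/-- The homogeneous length `[α] = ν_1 α_1 + ⋯ + ν_n α_n`. -/
def homLength (G : GradedLieGroup n) (α : Fin n → ℕ) : ℕ := ∑ j, G.weight j * α j

/-- The group convolution `(f * g)(x) = ∫ f(y) g(y⁻¹ x) dy`, for a real-valued `g`. -/
noncomputable def conv {F : Type*} [NormedAddCommGroup F] [NormedSpace ℝ F]
    (G : GradedLieGroup n) (f : (Fin n → ℝ) → F) (g : (Fin n → ℝ) → ℝ) (x : Fin n → ℝ) : F :=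
  ∫ y, g (G.mul (-y) x) • f y

/-- The rescaled function `ψ_w = w^{-Q} ψ ∘ D_{w⁻¹}`. -/
noncomputable def rescale (G : GradedLieGroup n) (ψ : (Fin n → ℝ) → ℝ) (w : ℝ)
    (x : Fin n → ℝ) : ℝ :=
  (w ^ G.homDim)⁻¹ * ψ (G.dilation w⁻¹ x)

/-- The left-invariant vector field `X_j f (x) = d/dt f(x · exp(t e_j))` at `t = 0`. -/
noncomputable def vectorField (G : GradedLieGroup n) (j : Fin n) (f : (Fin n → ℝ) → ℂ)
    (x : Fin n → ℝ) : ℂ :=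
  deriv (fun t : ℝ => f (G.mul x (t • Pi.single j 1))) 0

/-- `X^α f = X_1^{α_1} ⋯ X_n^{α_n} f`. -/
noncomputable def monomial (G : GradedLieGroup n) (α : Fin n → ℕ) (f : (Fin n → ℝ) → ℂ) :
    (Fin n → ℝ) → ℂ :=
  (List.finRange n).foldr (fun j h => (G.vectorField j)^[α j] h) f

/-- The left-invariant differential operator `∑_α c_α X^α`. -/
noncomputable def diffOp (G : GradedLieGroup n) (c : (Fin n → ℕ) →₀ ℂ) (f : (Fin n → ℝ) → ℂ)
    (x : Fin n → ℝ) : ℂ :=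
  c.sum fun α a => a * G.monomial α f x

/-- A (strongly continuous) unitary representation of `G` on a Hilbert space `H`. -/
structure UnitaryRep (G : GradedLieGroup n) (H : Type) [NormedAddCommGroup H]
    [InnerProductSpace ℂ H] where
  toFun : (Fin n → ℝ) → (H ≃ₗᵢ[ℂ] H)
  map_mul : ∀ x y v, toFun (G.mul x y) v = toFun x (toFun y v)
  continuous : ∀ v, Continuous fun x => toFun x v

namespace UnitaryRep

variable {G : GradedLieGroup n} {H : Type} [NormedAddCommGroup H] [InnerProductSpace ℂ H]

/-- Topological irreducibility. -/
def IsIrreducible (π : UnitaryRep G H) : Prop :=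
  Nontrivial H ∧ ∀ K : Submodule ℂ H, IsClosed (K : Set H) →
    (∀ x, ∀ v ∈ K, π.toFun x v ∈ K) → K = ⊥ ∨ K = ⊤

/-- `π` is not the trivial representation. -/
def IsNontrivial (π : UnitaryRep G H) : Prop := ∃ x v, π.toFun x v ≠ v

/-- Smooth vectors. -/
def IsSmoothVector (π : UnitaryRep G H) (v : H) : Prop := ContDiff ℝ ∞ fun x => π.toFun x v

/-- `π(X_j) v = d/dt π(exp(t e_j)) v` at `t = 0`. -/
noncomputable def vectorField (π : UnitaryRep G H) (j : Fin n) (v : H) : H :=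
  deriv (fun t : ℝ => π.toFun (t • Pi.single j 1) v) 0

/-- `π(X)^α v = π(X_1)^{α_1} ⋯ π(X_n)^{α_n} v`. -/
noncomputable def monomial (π : UnitaryRep G H) (α : Fin n → ℕ) (v : H) : H :=
  (List.finRange n).foldr (fun j h => (π.vectorField j)^[α j] h) v

/-- `∑_α c_α π(X)^α v`. -/
noncomputable def diffOp (π : UnitaryRep G H) (c : (Fin n → ℕ) →₀ ℂ) (v : H) : H :=
  c.sum fun α a => a • π.monomial α v

end UnitaryRep

/-- `∑_α c_α X^α` is a positive Rockland operator of homogeneous degree `ν`. -/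
structure IsPositiveRockland (G : GradedLieGroup n) (c : (Fin n → ℕ) →₀ ℂ) (ν : ℕ) : Prop where
  degree_pos : 0 < ν
  homogeneous : ∀ α ∈ c.support, G.homLength α = ν
  /-- The Rockland condition: `π(R)` is injective on the smooth vectors of every nontrivial
  irreducible unitary representation. -/
  rockland : ∀ (H : Type) [NormedAddCommGroup H] [InnerProductSpace ℂ H] [CompleteSpace H]
    [TopologicalSpace.SeparableSpace H] (π : UnitaryRep G H), π.IsIrreducible → π.IsNontrivial →
    ∀ v, π.IsSmoothVector v → π.diffOp c v = 0 → v = 0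
  /-- `⟨R f, f⟩ ≥ 0` for every test function `f`. -/
  positive : ∀ f : (Fin n → ℝ) → ℂ, ContDiff ℝ ∞ f → HasCompactSupport f →
    (∫ x, G.diffOp c f x * starRingEnd ℂ (f x)).im = 0 ∧
      0 ≤ (∫ x, G.diffOp c f x * starRingEnd ℂ (f x)).re

/-- `A` is a non-negative self-adjoint operator on `L²(G)` that extends `∑_α c_α X^α`, defined on
the test functions.  A positive Rockland operator is essentially self-adjoint on test functions, so
that `A` is its only self-adjoint extension. -/
structure IsSelfAdjointExtension (G : GradedLieGroup n) (c : (Fin n → ℕ) →₀ ℂ)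
    (A : L2 n →ₗ.[ℂ] L2 n) : Prop where
  isSelfAdjoint : IsSelfAdjoint A
  nonneg : ∀ v : A.domain, 0 ≤ (inner ℂ (A v) (v : L2 n)).re
  extends_diffOp : ∀ f : (Fin n → ℝ) → ℂ, ContDiff ℝ ∞ f → HasCompactSupport f →
    ∃ v w : L2 n, v =ᵐ[volume] f ∧ w =ᵐ[volume] G.diffOp c f ∧ (v, w) ∈ A.graph

end GradedLieGroup

/-- A Friedrichs mollifier. -/
structure IsMollifier {n : ℕ} (ψ : (Fin n → ℝ) → ℝ) : Prop where
  contDiff : ContDiff ℝ ∞ ψ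
  hasCompactSupport : HasCompactSupport ψ
  integral_eq_one : ∫ x, ψ x = 1

/-- The scale `ρ(ε)`, `0 < ε ≤ 1`, of a mollification. -/
structure IsScale (ρ : ℝ → ℝ) : Prop where
  pos : ∀ ε ∈ Ioc (0 : ℝ) 1, 0 < ρ ε
  tendsto : Tendsto ρ (𝓝[>] 0) (𝓝 0)

/-- `u ∈ C([0,T]; L²)` solves `u_t + A u + W u = 0` on `(0, T]` and `u(0) = g`: for `0 < t ≤ T`,
`u` is differentiable in `L²` at `t`, `u(t)` lies in the domain of `A`, and `W u(t)` in `L²`. -/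
def IsHeatSolution {n : ℕ} (A : GradedLieGroup.L2 n →ₗ.[ℂ] GradedLieGroup.L2 n)
    (W : (Fin n → ℝ) → ℝ) (g : (Fin n → ℝ) → ℂ) (T : ℝ) (u : ℝ → GradedLieGroup.L2 n) : Prop :=
  ContinuousOn u (Icc 0 T) ∧ u 0 =ᵐ[volume] g ∧
    ∀ t ∈ Ioc 0 T, ∃ v w : GradedLieGroup.L2 n, (u t, v) ∈ A.graph ∧
      w =ᵐ[volume] (fun x => (W x : ℂ) * u t x) ∧ HasDerivWithinAt u (-(v + w)) (Icc 0 T) t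

/-- `u` is the solution, on `[0, T]`, of the Cauchy problem: it solves it, and it is the only one
that does. -/
def IsUniqueHeatSolution {n : ℕ} (A : GradedLieGroup.L2 n →ₗ.[ℂ] GradedLieGroup.L2 n)
    (W : (Fin n → ℝ) → ℝ) (g : (Fin n → ℝ) → ℂ) (T : ℝ) (u : ℝ → GradedLieGroup.L2 n) : Prop :=
  IsHeatSolution A W g T u ∧ ∀ u', IsHeatSolution A W g T u' → EqOn u' u (Icc 0 T)

/-! The argument is Hilbert space theory for a non-negative self-adjoint `A`, together with
mollification on the group.

Existence of `A` is the Friedrichs construction (`exists_friedrichs_extension`): complete the test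
functions for the form `⟨Sx, jy⟩ + ⟨jx, jy⟩`, map the completion to `L²` by a contraction `J` with
dense range, and take `J J*` as the resolvent `(A + 1)⁻¹`.

For solvability, add a constant to the bounded potential so that `A + W ≥ 0`. Then `R = (A + W +
1)⁻¹` is bounded and self-adjoint with spectrum in `[0, 1]`, and `exp (-t (A + W))` is `f_t(R)` with
`f_t(s) = exp (-t (1/s - 1))`. For `t > 0` both `f_t(s)` and `f_t(s)/s` extend continuously by `0`
to `s = 0`, so the continuous functional calculus of the bounded operator `R` suffices. The
factorisation `f_t(s) = s · (f_t(s)/s)` puts `f_t(R) g` in the range of `R`, hence in the domain,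
for every `g`: this gives classical solutions for arbitrary `L²` data (`exists_heat_solution`).

Since `A ≥ 0`, it drops out of the energy identity. The growth bound, uniqueness and continuous
dependence on potential and data (`IsHeatSolution.norm_sub_sq_le`) all follow by Gronwall.

It remains to prove `V * ψ_ε → V` uniformly and `u₀ * φ_ε → u₀` in `L²`. These rest on Young's
inequality and on the invariance of Lebesgue measure under translations, whose differentials are
unipotent with respect to the grading. -/

/-! ### Self-adjoint operators: Friedrichs extension and resolvent -/

section SelfAdjoint

variable {H : Type*} [NormedAddCommGroup H] [InnerProductSpace ℂ H] [CompleteSpace H]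

/-- Weak solutions are strong: the graph of a self-adjoint operator is its own adjoint, so testing
against the graph decides membership. -/
theorem IsSelfAdjoint.mem_graph_of_inner_eq {A : H →ₗ.[ℂ] H} (hA : IsSelfAdjoint A) {x y : H}
    (h : ∀ a b, (a, b) ∈ A.graph → inner ℂ b x = inner ℂ a y) : (x, y) ∈ A.graph := by
  have h1 := LinearPMap.adjoint_graph_eq_graph_adjoint hA.dense_domain
  rw [LinearPMap.isSelfAdjoint_def.mp hA] at h1
  rw [h1, Submodule.mem_adjoint_iff]
  exact fun a b hab => sub_eq_zero.2 (h a b hab)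

theorem IsSelfAdjoint.graph_inner_eq {A : H →ₗ.[ℂ] H} (hA : IsSelfAdjoint A) {x y a b : H}
    (h : (x, y) ∈ A.graph) (hab : (a, b) ∈ A.graph) : inner ℂ b x = inner ℂ a y := by
  have h1 := LinearPMap.adjoint_graph_eq_graph_adjoint hA.dense_domain
  rw [LinearPMap.isSelfAdjoint_def.mp hA] at h1
  rw [h1, Submodule.mem_adjoint_iff] at h
  exact sub_eq_zero.1 (h a b hab)

/-- A self-adjoint injective bounded operator has dense range. -/
theorem denseRange_of_symmetric_injective (R : H →L[ℂ] H)
    (hR : ∀ x y, inner ℂ (R x) y = inner ℂ x (R y)) (hinj : ∀ x, R x = 0 → x = 0) :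
    DenseRange R := by
  have h1 : (LinearMap.range R.toLinearMap).topologicalClosure = ⊤ := by
    rw [Submodule.topologicalClosure_eq_top_iff, Submodule.eq_bot_iff]
    intro x hx
    apply hinj
    have h2 : inner ℂ (R (R x)) x = 0 := (Submodule.mem_orthogonal _ _).1 hx _ ⟨R x, rfl⟩
    rw [hR] at h2
    exact inner_self_eq_zero.1 h2
  rw [← Submodule.dense_iff_topologicalClosure_eq_top] at h1
  exact h1

/-- If `0 ≤ R` is bounded, injective, and `‖R h‖² ≤ ⟨R h, h⟩`, then `R⁻¹ - 1` is a non-negative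
self-adjoint operator. -/
theorem exists_selfAdjoint_of_resolvent (R : H →L[ℂ] H)
    (hR : ∀ x y, inner ℂ (R x) y = inner ℂ x (R y)) (hinj : ∀ x, R x = 0 → x = 0)
    (hle : ∀ x, ‖R x‖ ^ 2 ≤ (inner ℂ x (R x)).re) :
    ∃ A : H →ₗ.[ℂ] H, IsSelfAdjoint A ∧ (∀ v : A.domain, 0 ≤ (inner ℂ (A v) (v : H)).re) ∧
      ∀ x, (R x, x - R x) ∈ A.graph := by
  let g : Submodule ℂ (H × H) :=
    LinearMap.range (R.toLinearMap.prod (LinearMap.id - R.toLinearMap))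
  have hg : ∀ x : H × H, x ∈ g → x.1 = 0 → x.2 = 0 := by
    rintro _ ⟨x, rfl⟩ hx
    have : x = 0 := hinj x hx
    simp [this]
  have hgr : g.toLinearPMap.graph = g := Submodule.toLinearPMap_graph_eq g hg
  have hmem : ∀ x, (R x, x - R x) ∈ g.toLinearPMap.graph := fun x => by
    rw [hgr]; exact ⟨x, rfl⟩
  have hdense : Dense (g.toLinearPMap.domain : Set H) := by
    refine (denseRange_of_symmetric_injective R hR hinj).mono ?_
    rintro _ ⟨x, rfl⟩
    exact LinearPMap.mem_domain_of_mem_graph (hmem x)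
  refine ⟨g.toLinearPMap, ?_, ?_, hmem⟩
  · rw [LinearPMap.isSelfAdjoint_def]
    apply LinearPMap.eq_of_eq_graph
    rw [LinearPMap.adjoint_graph_eq_graph_adjoint hdense, hgr]
    ext ⟨x, y⟩
    rw [Submodule.mem_adjoint_iff]
    constructor
    · intro h
      -- If `y = A* x`, then `(A + 1) x` should be `x + y`, so the claim is `x = R (x + y)`.
      refine ⟨x + y, ?_⟩
      have h1 : R (x + y) = x := by
        refine ext_inner_left ℂ fun z => ?_
        have := h (R z) (z - R z) ⟨z, rfl⟩
        simp only [inner_sub_left] at this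
        rw [← hR, inner_add_right]
        linear_combination -this
      ext
      · exact h1
      · change (x + y) - R (x + y) = y
        rw [h1]; abel
    · rintro ⟨z, hz⟩ a b ⟨w, hw⟩
      obtain ⟨rfl, rfl⟩ := Prod.ext_iff.1 hz
      obtain ⟨rfl, rfl⟩ := Prod.ext_iff.1 hw
      change inner ℂ (w - R w) (R z) - inner ℂ (R w) (z - R z) = 0
      rw [inner_sub_left, inner_sub_right, hR w (R z), ← hR w z]
      ring
  · intro v
    have hv := LinearPMap.mem_graph g.toLinearPMap v
    rw [hgr] at hv
    obtain ⟨x, hx⟩ := hv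
    have h1 : R x = v := congrArg Prod.fst hx
    have h2 : x - R x = g.toLinearPMap v := congrArg Prod.snd hx
    rw [← h1, ← h2, inner_sub_left, Complex.sub_re, sub_nonneg]
    have h3 := hle x
    rwa [← inner_self_eq_norm_sq (𝕜 := ℂ)] at h3

/-- **Friedrichs extension**, for an operator that is bounded below by a complete form. -/
theorem exists_selfAdjoint_of_form {K : Type*} [NormedAddCommGroup K] [InnerProductSpace ℂ K]
    [CompleteSpace K] (J : K →L[ℂ] H) (hJ : ‖J‖ ≤ 1) (hd : DenseRange J) :
    ∃ A : H →ₗ.[ℂ] H, IsSelfAdjoint A ∧ (∀ v : A.domain, 0 ≤ (inner ℂ (A v) (v : H)).re) ∧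
      ∀ x, (J (J.adjoint x), x - J (J.adjoint x)) ∈ A.graph := by
  -- `J* h` is the Riesz representative of `⟨h, J ·⟩`, the weak solution of `(A + 1) x = h`.
  -- Injectivity of `J` is not needed: dense range of `J` makes `J*`, and hence `J J*`, injective.
  refine exists_selfAdjoint_of_resolvent (J ∘L J.adjoint) ?_ ?_ ?_
  · intro x y
    simp only [ContinuousLinearMap.comp_apply]
    rw [← ContinuousLinearMap.adjoint_inner_right, ← ContinuousLinearMap.adjoint_inner_left J]
  · intro x hx
    have h1 : J.adjoint x = 0 := by
      rw [← inner_self_eq_zero (𝕜 := ℂ), ContinuousLinearMap.adjoint_inner_left]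
      simp only [ContinuousLinearMap.comp_apply] at hx
      rw [hx, inner_zero_right]
    refine hd.eq_zero_of_inner_left ℂ fun y => ?_
    rw [← ContinuousLinearMap.adjoint_inner_left, h1, inner_zero_left]
  · intro x
    simp only [ContinuousLinearMap.comp_apply]
    rw [← ContinuousLinearMap.adjoint_inner_left]
    have h1 := inner_self_eq_norm_sq (𝕜 := ℂ) (J.adjoint x)
    simp only [RCLike.re_to_complex] at h1
    rw [h1]
    gcongr
    exact (J.le_opNorm _).trans (mul_le_of_le_one_left (norm_nonneg _) hJ)

/-- Polarization: with `d(x, y)` the difference of the two sides, reality at `x + y` gives `d(x, y)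
= -d(y, x)`, and reality at `x + iy` gives `d(x, y) = d(y, x)`. -/
theorem inner_eq_of_inner_self_im_eq_zero {E F : Type*} [AddCommGroup E] [Module ℂ E]
    [NormedAddCommGroup F] [InnerProductSpace ℂ F] (j S : E →ₗ[ℂ] F) (h : ∀ x, (inner ℂ (S x) (j x)).im = 0) (x y : E) :
    inner ℂ (S x) (j y) = inner ℂ (j x) (S y) := by
  have h0 : ∀ x, inner ℂ (S x) (j x) = inner ℂ (j x) (S x) := fun x => by
    rw [← inner_conj_symm (j x)]
    exact (Complex.conj_eq_iff_im.2 (h x)).symm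
  have h1 := h0 (x + y)
  have h2 := h0 (x + Complex.I • y)
  simp only [map_add, map_smul, inner_add_left, inner_add_right, inner_smul_left, inner_smul_right,
    Complex.conj_I] at h1 h2
  have hx := h0 x
  have hy := h0 y
  have hI := Complex.I_sq
  have h3 : inner ℂ (S x) (j y) - inner ℂ (j x) (S y)
      = -(inner ℂ (S y) (j x) - inner ℂ (j y) (S x)) := by
    linear_combination h1 - hx - hy
  have h4 : Complex.I * (inner ℂ (S x) (j y) - inner ℂ (j x) (S y))
      = Complex.I * (inner ℂ (S y) (j x) - inner ℂ (j y) (S x)) := by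
    linear_combination h2 - hx + Complex.I ^ 2 * hy
  have h5 := mul_left_cancel₀ Complex.I_ne_zero h4
  linear_combination (h3 + h5) / 2

/-- **Friedrichs extension** of a densely defined non-negative symmetric operator `j x ↦ S x`. -/
theorem exists_friedrichs_extension {E : Type*} [AddCommGroup E] [Module ℂ E]
    (j S : E →ₗ[ℂ] H) (hj : DenseRange j)
    (him : ∀ x, (inner ℂ (S x) (j x)).im = 0) (hre : ∀ x, 0 ≤ (inner ℂ (S x) (j x)).re) :
    ∃ A : H →ₗ.[ℂ] H, IsSelfAdjoint A ∧ (∀ v : A.domain, 0 ≤ (inner ℂ (A v) (v : H)).re) ∧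
      ∀ x, (j x, S x) ∈ A.graph := by
  have hsym := inner_eq_of_inner_self_im_eq_zero j S him
  -- The form of `S + 1`. It is only semidefinite on `E`, as `j` may have a kernel; the completion
  -- separates points.
  let core : PreInnerProductSpace.Core ℂ E :=
    { inner := fun x y => inner ℂ (S x) (j y) + inner ℂ (j x) (j y)
      conj_inner_symm := fun x y => by
        simp only [map_add, inner_conj_symm, hsym]
      re_inner_nonneg := fun x => by
        simp only [map_add]
        exact add_nonneg (hre x) inner_self_nonneg
      add_left := fun x y z => by simp only [map_add, inner_add_left]; ring
      smul_left := fun x y r => by simp only [map_smul, inner_smul_left]; ring }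
  let : SeminormedAddCommGroup E := InnerProductSpace.Core.toSeminormedAddCommGroup (c := core)
  let : InnerProductSpace ℂ E := InnerProductSpace.ofCore core
  have hin : ∀ x y : E, inner ℂ x y = inner ℂ (S x) (j y) + inner ℂ (j x) (j y) := fun _ _ => rfl
  have hbd : ∀ x : E, ‖j x‖ ≤ 1 * ‖x‖ := fun x => by
    rw [one_mul]
    refine (sq_le_sq₀ (norm_nonneg _) (norm_nonneg _)).1 ?_
    rw [← inner_self_eq_norm_sq (𝕜 := ℂ) x, hin, map_add, ← inner_self_eq_norm_sq (𝕜 := ℂ) (j x)]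
    have := hre x
    simp only [RCLike.re_to_complex]
    linarith
  let j' : E →L[ℂ] H := j.mkContinuous 1 hbd
  let ι : E →L[ℂ] UniformSpace.Completion E := UniformSpace.Completion.toComplL
  have hιd : DenseRange ι := UniformSpace.Completion.denseRange_coe
  let J : UniformSpace.Completion E →L[ℂ] H := j'.extend ι
  have hJι : ∀ x, J (ι x) = j x := fun x =>
    ContinuousLinearMap.extend_eq j' hιd (UniformSpace.Completion.isUniformInducing_coe E) x
  have hJn : ‖J‖ ≤ 1 := by
    refine ContinuousLinearMap.opNorm_le_bound _ zero_le_one fun x => ?_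
    induction x using UniformSpace.Completion.induction_on with
    | hp => exact isClosed_le (by fun_prop) (by fun_prop)
    | ih x =>
      have := hJι x
      change J (x : UniformSpace.Completion E) = j x at this
      rw [this, UniformSpace.Completion.norm_coe]
      exact hbd x
  have hJd : DenseRange J := by
    refine hj.mono ?_
    rintro _ ⟨x, rfl⟩
    exact ⟨ι x, hJι x⟩
  obtain ⟨A, hA, hA0, hgr⟩ := exists_selfAdjoint_of_form J hJn hJd
  refine ⟨A, hA, hA0, fun x => ?_⟩
  -- The form was chosen so that `x` itself solves `(A + 1) x = S x + j x` weakly; density of `E` in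
  -- the completion is enough to test this.
  have h1 : J.adjoint (S x + j x) = ι x := by
    refine hιd.eq_of_inner_left ℂ fun y => ?_
    rw [ContinuousLinearMap.adjoint_inner_left, hJι]
    change _ = inner ℂ (x : UniformSpace.Completion E) (y : UniformSpace.Completion E)
    rw [UniformSpace.Completion.inner_coe, hin, inner_add_left]
  have h2 := hgr (S x + j x)
  rwa [h1, hJι, add_sub_cancel_right] at h2

/-- The resolvent `(A + W + 1)⁻¹` of a bounded self-adjoint perturbation of a self-adjoint operator
with `A + W ≥ 0`. -/
theorem exists_resolvent {A : H →ₗ.[ℂ] H} (hA : IsSelfAdjoint A) (W : H →L[ℂ] H)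
    (hW : ∀ x y, inner ℂ (W x) y = inner ℂ x (W y))
    (hpos : ∀ x y, (x, y) ∈ A.graph → 0 ≤ (inner ℂ (y + W x) x).re) :
    ∃ R : H →L[ℂ] H, IsSelfAdjoint R ∧ (∀ h, 0 ≤ (inner ℂ (R h) h).re) ∧ ‖R‖ ≤ 1 ∧ DenseRange R ∧
      ∀ h, (R h, h - R h - W (R h)) ∈ A.graph := by
  -- `A + W + 1` as a bounded operator on the graph, which is complete because `A` is closed.
  -- Positivity bounds `T` below, so its range is closed, and self-adjointness kills the orthogonal
  -- complement of the range.
  let T : A.graph →L[ℂ] H :=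
    (ContinuousLinearMap.snd ℂ H H + (W + 1) ∘L ContinuousLinearMap.fst ℂ H H) ∘L A.graph.subtypeL
  have hT : ∀ p : A.graph, T p = p.1.2 + (W p.1.1 + p.1.1) := fun p => rfl
  have hcl : IsClosed (A.graph : Set (H × H)) := hA.isClosed
  have : CompleteSpace A.graph := hcl.completeSpace_coe
  have hre : ∀ p : A.graph, ‖p.1.1‖ ^ 2 ≤ (inner ℂ (T p) p.1.1).re := fun p => by
    have h1 := hpos p.1.1 p.1.2 p.2
    rw [hT, ← add_assoc, inner_add_left, Complex.add_re]
    have h2 := inner_self_eq_norm_sq (𝕜 := ℂ) p.1.1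
    simp only [RCLike.re_to_complex] at h2
    linarith
  have hfst : ∀ p : A.graph, ‖p.1.1‖ ≤ ‖T p‖ := fun p => by
    have h1 := (hre p).trans ((Complex.re_le_norm _).trans (norm_inner_le_norm _ _))
    by_contra! hlt
    have := norm_nonneg (T p)
    nlinarith [norm_nonneg p.1.1]
  have hinj : Function.Injective T := by
    rw [injective_iff_map_eq_zero]
    rintro ⟨⟨x, y⟩, hp⟩ h0
    have h1 := hfst ⟨⟨x, y⟩, hp⟩
    rw [h0, norm_zero] at h1
    have hx : x = 0 := norm_le_zero_iff.1 h1
    rw [hT] at h0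
    simp only [hx, map_zero, add_zero] at h0
    ext <;> simp [hx, h0]
  have hanti : AntilipschitzWith (‖W‖₊ + 2) T := by
    refine ContinuousLinearMap.antilipschitz_of_bound _ fun p => ?_
    have h2 : ‖p.1.2‖ ≤ ‖T p‖ + (‖W‖ * ‖p.1.1‖ + ‖p.1.1‖) := by
      have : p.1.2 = T p - (W p.1.1 + p.1.1) := by rw [hT]; abel
      rw [this]
      refine (norm_sub_le _ _).trans ?_
      gcongr
      exact (norm_add_le _ _).trans (by gcongr; exact W.le_opNorm _)
    have h3 := hfst p
    have h4 : ‖W‖ * ‖p.1.1‖ ≤ ‖W‖ * ‖T p‖ := by gcongr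
    have h5 : ‖p‖ = max ‖p.1.1‖ ‖p.1.2‖ := rfl
    rw [h5]
    push_cast
    have h6 : 0 ≤ ‖W‖ * ‖T p‖ := by positivity
    refine max_le ?_ ?_ <;> nlinarith [norm_nonneg (T p)]
  have hrc : IsClosed (LinearMap.range T.toLinearMap : Set H) := by
    exact hanti.isClosed_range T.uniformContinuous
  have hsurj : Function.Surjective T := by
    have h1 : (LinearMap.range T.toLinearMap)ᗮ = ⊥ := by
      rw [Submodule.eq_bot_iff]
      intro h hh
      -- A vector orthogonal to the range lies in the domain with `A h = -(W h + h)`, that is, in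
      -- the kernel of `A + W + 1`.
      have h2 : (h, -(W h + h)) ∈ A.graph := by
        refine hA.mem_graph_of_inner_eq fun a b hab => ?_
        have h3 : inner ℂ (b + (W a + a)) h = 0 :=
          (Submodule.mem_orthogonal _ _).1 hh _ ⟨⟨(a, b), hab⟩, rfl⟩
        rw [inner_add_left, inner_add_left, hW] at h3
        rw [inner_neg_right, inner_add_right]
        linear_combination h3
      have h4 : T ⟨_, h2⟩ = 0 := by rw [hT]; simp
      have h5 := hinj (h4.trans T.map_zero.symm)
      exact congrArg (fun p : A.graph => p.1.1) h5
    have h2 := (Submodule.topologicalClosure_eq_top_iff).2 h1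
    rw [IsClosed.submodule_topologicalClosure_eq hrc] at h2
    exact LinearMap.range_eq_top.1 h2
  let e := LinearEquiv.ofBijective T.toLinearMap ⟨hinj, hsurj⟩
  have he : ∀ h, T (e.symm h) = h := fun h => e.apply_symm_apply h
  let R : H →L[ℂ] H := LinearMap.mkContinuous
    (LinearMap.fst ℂ H H ∘ₗ A.graph.subtype ∘ₗ e.symm.toLinearMap) 1 fun h => by
      have := hfst (e.symm h)
      rw [he] at this
      rw [one_mul]
      exact this
  have hRe : ∀ h, R h = (e.symm h).1.1 := fun h => rfl
  have hgr : ∀ h, (R h, h - R h - W (R h)) ∈ A.graph := fun h => by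
    have h1 := he h
    rw [hT] at h1
    have h2 : (e.symm h).1.2 = h - R h - W (R h) := by
      rw [hRe]; nth_rewrite 2 [← h1]; abel
    rw [← h2, hRe]
    exact (e.symm h).2
  refine ⟨R, ?_, ?_, ?_, ?_, hgr⟩
  · rw [ContinuousLinearMap.isSelfAdjoint_iff_isSymmetric]
    intro x y
    have h1 := hA.graph_inner_eq (hgr y) (hgr x)
    simp only [inner_sub_left, inner_sub_right, hW] at h1
    change inner ℂ (R x) y = inner ℂ x (R y)
    linear_combination -h1
  · intro h
    have h1 := hre (e.symm h)
    rw [he, ← hRe, ← inner_conj_symm, Complex.conj_re] at h1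
    exact (sq_nonneg _).trans h1
  · exact LinearMap.mkContinuous_norm_le _ zero_le_one _
  · refine hA.dense_domain.mono fun x hx => ?_
    obtain ⟨y, hy⟩ := LinearPMap.mem_domain_iff.1 hx
    refine ⟨T ⟨(x, y), hy⟩, ?_⟩
    rw [hRe]
    have : e.symm (T ⟨(x, y), hy⟩) = ⟨(x, y), hy⟩ := e.symm_apply_apply _
    rw [this]

end SelfAdjoint

/-! ### Scalar estimates for the heat semigroup as a function of the resolvent -/

section HeatFunction

/-- The function `s ↦ exp (-t (1/s - 1))` of the resolvent `s = 1 / (1 + λ)`, extended by `0` to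
`s ≤ 0`. -/
noncomputable def resolventExp (t s : ℝ) : ℝ := Real.exp t * expNegInvGlue (t⁻¹ * s)

theorem resolventExp_zero (t : ℝ) : resolventExp t 0 = 0 := by
  simp [resolventExp, expNegInvGlue.zero]

theorem resolventExp_of_pos {t s : ℝ} (ht : 0 < t) (hs : 0 < s) :
    resolventExp t s = Real.exp (-(t * (s⁻¹ - 1))) := by
  have h : ¬ t⁻¹ * s ≤ 0 := not_le.2 (by positivity)
  rw [resolventExp, expNegInvGlue, if_neg h, ← Real.exp_add]
  congr 1
  field_simp
  ring

theorem continuous_resolventExp (t : ℝ) : Continuous (resolventExp t) := by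
  unfold resolventExp
  have : Continuous expNegInvGlue := (expNegInvGlue.contDiff (n := 0)).continuous
  fun_prop

/-- `exp (-t/s)` beats `1/s` as `s ↓ 0`. Applied to the resolvent, this function provides the
preimage under `R` that puts the solution in the domain. -/
theorem continuous_inv_mul_resolventExp {t : ℝ} (ht : 0 < t) :
    Continuous fun s => s⁻¹ * resolventExp t s := by
  have h1 : Continuous fun s : ℝ =>
      (t⁻¹ * Real.exp t) * ((Polynomial.X : Polynomial ℝ).eval (t⁻¹ * s)⁻¹
        * expNegInvGlue (t⁻¹ * s)) :=
    continuous_const.mul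
      ((expNegInvGlue.continuous_polynomial_eval_inv_mul Polynomial.X).comp (continuous_const_mul _))
  refine h1.congr fun s => ?_
  rw [Polynomial.eval_X, resolventExp, mul_inv, inv_inv]
  field_simp

theorem mul_inv_mul_resolventExp (t s : ℝ) : s * (s⁻¹ * resolventExp t s) = resolventExp t s := by
  rcases eq_or_ne s 0 with rfl | hs
  · rw [resolventExp_zero]; ring
  · field_simp

theorem resolventExp_nonneg (t s : ℝ) : 0 ≤ resolventExp t s :=
  mul_nonneg (Real.exp_pos _).le (expNegInvGlue.nonneg _)

theorem resolventExp_le_one {t s : ℝ} (ht : 0 < t) (hs : s ∈ Icc (0 : ℝ) 1) :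
    resolventExp t s ≤ 1 := by
  rcases hs.1.eq_or_lt with rfl | h0
  · rw [resolventExp_zero]; exact zero_le_one
  · rw [resolventExp_of_pos ht h0, Real.exp_le_one_iff, neg_nonpos]
    exact mul_nonneg ht.le (sub_nonneg.2 ((one_le_inv₀ h0).2 hs.2))

/-- With `x = 1/s - 1`, the inequality `1 - e^{-tx} ≤ tx` gives `s (1 - e^{-tx}) ≤ t (1 - s) ≤ t`.
This is the rate of strong convergence on the range of the resolvent. -/
theorem abs_resolventExp_mul_sub_le {t s : ℝ} (ht : 0 < t) (hs : s ∈ Icc (0 : ℝ) 1) :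
    |resolventExp t s * s - s| ≤ t := by
  rcases hs.1.eq_or_lt with rfl | h0
  · simpa using ht.le
  · have h1 := resolventExp_le_one ht hs
    rw [abs_le]
    have h2 := Real.add_one_le_exp (-(t * (s⁻¹ - 1)))
    rw [← resolventExp_of_pos ht h0] at h2
    have h3 : (-(t * (s⁻¹ - 1)) + 1) * s ≤ resolventExp t s * s := by gcongr
    have h4 : (-(t * (s⁻¹ - 1)) + 1) * s = - t + t * s + s := by field_simp; ring
    have h5 : 0 ≤ t * s := by positivity
    have h6 : resolventExp t s * s ≤ 1 * s := by gcongr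
    constructor <;> linarith

theorem Real.abs_exp_sub_one_sub_le (y : ℝ) : |Real.exp y - 1 - y| ≤ y ^ 2 * Real.exp |y| := by
  have h := Complex.norm_exp_sub_sum_le_norm_mul_exp (y : ℂ) 2
  rw [Finset.sum_range_succ, Finset.sum_range_one] at h
  simp only [pow_zero, Nat.factorial_zero, Nat.cast_one, div_one, pow_one, Nat.factorial_one,
    Complex.norm_real, Real.norm_eq_abs, sq_abs] at h
  rw [← Complex.ofReal_exp, ← Complex.ofReal_one, ← Complex.ofReal_add, ← Complex.ofReal_sub,
    Complex.norm_real, Real.norm_eq_abs] at h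
  rwa [sub_sub]

/-- Second order Taylor estimate in `t`, uniform in `s`. -/
theorem abs_resolventExp_taylor {t t' s : ℝ} (ht : 0 < t) (ht' : |t' - t| ≤ t / 2)
    (hs : s ∈ Icc (0 : ℝ) 1) :
    |resolventExp t' s - resolventExp t s
      + (t' - t) * (s⁻¹ * resolventExp t s - resolventExp t s)| ≤ 8 / t ^ 2 * (t' - t) ^ 2 := by
  rcases hs.1.eq_or_lt with rfl | h0
  · simp only [resolventExp_zero, mul_zero, sub_zero, add_zero, abs_zero]
    positivity
  have htp : 0 < t' := by have := (abs_le.1 ht').1; linarith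
  set x := s⁻¹ - 1 with hx
  have hx0 : 0 ≤ x := sub_nonneg.2 ((one_le_inv₀ h0).2 hs.2)
  set h := t' - t with hh
  rw [resolventExp_of_pos ht h0, resolventExp_of_pos htp h0, ← hx]
  have h1 : Real.exp (-(t' * x)) = Real.exp (-(t * x)) * Real.exp (-(h * x)) := by
    rw [← Real.exp_add, hh]; congr 1; ring
  have h2 : Real.exp (-(t' * x)) - Real.exp (-(t * x))
      + h * (s⁻¹ * Real.exp (-(t * x)) - Real.exp (-(t * x)))
      = Real.exp (-(t * x)) * (Real.exp (-(h * x)) - 1 - (-(h * x))) := by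
    rw [h1, hx]; ring
  rw [h2, abs_mul, abs_of_pos (Real.exp_pos _)]
  have h3 := Real.abs_exp_sub_one_sub_le (-(h * x))
  rw [abs_neg, abs_mul, abs_of_nonneg hx0] at h3
  -- The Taylor remainder is at most `(hx)² e^{|h|x}`, with `|h| x ≤ y`, against the decay `e^{-tx}
  -- = e^{-y} e^{-y}`. One factor pays for `e^{|h|x}`, the other for `x²` through `y² e^{-y} ≤ 2`;
  -- since `x² = 4y²/t²`, the constant is `8/t²`.
  set y := t / 2 * x with hy
  have hy0 : 0 ≤ y := by positivity
  have h4 : Real.exp (|h| * x) ≤ Real.exp y := by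
    rw [Real.exp_le_exp]
    exact mul_le_mul_of_nonneg_right ht' hx0
  have h5 : Real.exp (-(t * x)) = Real.exp (-y) * Real.exp (-y) := by
    rw [← Real.exp_add]; congr 1; rw [hy]; ring
  have h6 : Real.exp (-y) * Real.exp y = 1 := by rw [← Real.exp_add]; simp
  have h7 : y ^ 2 * Real.exp (-y) ≤ 2 := by
    have := Real.quadratic_le_exp_of_nonneg hy0
    have h8 : y ^ 2 ≤ 2 * Real.exp y := by nlinarith
    calc y ^ 2 * Real.exp (-y) ≤ 2 * Real.exp y * Real.exp (-y) := by gcongr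
      _ = 2 * (Real.exp (-y) * Real.exp y) := by ring
      _ = 2 := by rw [h6]; ring
  calc Real.exp (-(t * x)) * |Real.exp (-(h * x)) - 1 - -(h * x)|
      ≤ Real.exp (-(t * x)) * ((-(h * x)) ^ 2 * Real.exp y) := by
        gcongr
        exact h3.trans (by gcongr)
    _ = h ^ 2 * x ^ 2 * Real.exp (-y) * (Real.exp (-y) * Real.exp y) := by rw [h5]; ring
    _ = 4 / t ^ 2 * h ^ 2 * (y ^ 2 * Real.exp (-y)) := by rw [h6, hy]; field_simp; ring
    _ ≤ 4 / t ^ 2 * h ^ 2 * 2 := by gcongr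
    _ = 8 / t ^ 2 * h ^ 2 := by ring

end HeatFunction

/-! ### The heat semigroup by continuous functional calculus -/

section Semigroup

variable {H : Type*} [NormedAddCommGroup H] [InnerProductSpace ℂ H] [CompleteSpace H]

theorem spectrum_subset_Icc {R : H →L[ℂ] H} (hR : IsSelfAdjoint R)
    (hpos : ∀ h, 0 ≤ (inner ℂ (R h) h).re) (hn : ‖R‖ ≤ 1) : spectrum ℝ R ⊆ Icc 0 1 := by
  intro s hs
  have h0 : 0 ≤ R := by
    rw [ContinuousLinearMap.nonneg_iff_isPositive, ContinuousLinearMap.isPositive_def']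
    exact ⟨hR, hpos⟩
  refine ⟨spectrum_nonneg_of_nonneg h0 hs, ?_⟩
  have := spectrum.norm_le_norm_mul_of_mem hs
  -- Only an inequality, since `H` may be trivial.
  have h1 : ‖(1 : H →L[ℂ] H)‖ ≤ 1 := ContinuousLinearMap.norm_id_le
  calc s ≤ ‖s‖ := Real.le_norm_self s
    _ ≤ ‖R‖ * ‖(1 : H →L[ℂ] H)‖ := this
    _ ≤ 1 * 1 := by gcongr
    _ = 1 := one_mul 1

/-- The second order Taylor estimate is uniform on `[0, 1]`, which contains the spectrum, so the
functional calculus turns it into an operator norm estimate. -/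
theorem hasDerivAt_cfc_resolventExp {R : H →L[ℂ] H} (_ : IsSelfAdjoint R)
    (hs : spectrum ℝ R ⊆ Icc 0 1) {t : ℝ} (ht : 0 < t) :
    HasDerivAt (fun t => cfc (resolventExp t) R)
      (-(cfc (fun s => s⁻¹ * resolventExp t s) R - cfc (resolventExp t) R)) t := by
  have hc1 := (continuous_inv_mul_resolventExp ht).continuousOn (s := spectrum ℝ R)
  have hc2 := fun t => (continuous_resolventExp t).continuousOn (s := spectrum ℝ R)
  rw [hasDerivAt_iff_isLittleO]
  have h1 : (fun t' => cfc (resolventExp t') R - cfc (resolventExp t) R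
      - (t' - t) • (-(cfc (fun s => s⁻¹ * resolventExp t s) R - cfc (resolventExp t) R)))
      =O[𝓝 t] fun t' => (t' - t) ^ 2 := by
    refine Asymptotics.IsBigO.of_bound (8 / t ^ 2) ?_
    filter_upwards [Metric.closedBall_mem_nhds t (half_pos ht)] with t' ht'
    rw [Metric.mem_closedBall, Real.dist_eq] at ht'
    have h2 : cfc (resolventExp t') R - cfc (resolventExp t) R
        - (t' - t) • (-(cfc (fun s => s⁻¹ * resolventExp t s) R - cfc (resolventExp t) R))
        = cfc (fun s => resolventExp t' s - resolventExp t s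
            + (t' - t) * (s⁻¹ * resolventExp t s - resolventExp t s)) R := by
      have e1 : ContinuousOn (fun s => resolventExp t' s - resolventExp t s) (spectrum ℝ R) :=
        (hc2 t').sub (hc2 t)
      have e2 : ContinuousOn (fun s => s⁻¹ * resolventExp t s - resolventExp t s) (spectrum ℝ R) :=
        hc1.sub (hc2 t)
      have e3 : ContinuousOn (fun s => (t' - t) * (s⁻¹ * resolventExp t s - resolventExp t s))
        (spectrum ℝ R) := e2.const_mul (t' - t)
      rw [smul_neg, sub_neg_eq_add,
        cfc_add (f := fun s => resolventExp t' s - resolventExp t s)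
          (g := fun s => (t' - t) * (s⁻¹ * resolventExp t s - resolventExp t s)) (hf := e1)
          (hg := e3),
        cfc_sub (f := resolventExp t') (g := resolventExp t) (hf := hc2 t') (hg := hc2 t),
        cfc_const_mul _ _ _ e2,
        cfc_sub (f := fun s => s⁻¹ * resolventExp t s) (g := resolventExp t) (hf := hc1)
          (hg := hc2 t)]
    rw [h2]
    refine norm_cfc_le (by positivity) fun s hsp => ?_
    rw [Real.norm_eq_abs, Real.norm_eq_abs, abs_pow, sq_abs]
    exact abs_resolventExp_taylor ht ht' (hs hsp)
  refine h1.trans_isLittleO ?_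
  have h2 : (fun x : ℝ => x ^ 2) =o[𝓝 0] fun x => x := Asymptotics.isLittleO_pow_id one_lt_two
  have h3 : Tendsto (fun t' => t' - t) (𝓝 t) (𝓝 0) := by
    have : Tendsto (fun t' => t' - t) (𝓝 t) (𝓝 (t - t)) := (continuous_sub_right t).tendsto t
    rwa [sub_self] at this
  exact h2.comp_tendsto h3

/-- The bounded operators `exp (-t (R⁻¹ - 1))` converge strongly to `1` as `t → 0`. -/
theorem tendsto_cfc_resolventExp {R : H →L[ℂ] H} (hR : IsSelfAdjoint R)
    (hs : spectrum ℝ R ⊆ Icc 0 1) (hd : DenseRange R) (g : H) :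
    Tendsto (fun t => cfc (resolventExp t) R g) (𝓝[>] 0) (𝓝 g) := by
  have hc2 := fun t => (continuous_resolventExp t).continuousOn (s := spectrum ℝ R)
  rw [Metric.tendsto_nhds]
  intro δ hδ
  -- On the range of `R` the convergence has rate `t ‖h‖`; density and the contraction bound extend
  -- it to all `g`.
  obtain ⟨h, hh⟩ := hd.exists_dist_lt g (show 0 < δ / 3 by positivity)
  have hlim : ∀ᶠ t in 𝓝[>] (0 : ℝ), t * ‖h‖ < δ / 3 := by
    have h1 : Tendsto (fun t : ℝ => t * ‖h‖) (𝓝[>] 0) (𝓝 (0 * ‖h‖)) :=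
      ((continuous_mul_const ‖h‖).tendsto 0).mono_left nhdsWithin_le_nhds
    rw [zero_mul] at h1
    exact h1.eventually_lt_const (by positivity)
  filter_upwards [hlim, self_mem_nhdsWithin] with t ht1 ht
  have ht : 0 < t := ht
  have hn : ‖cfc (resolventExp t) R‖ ≤ 1 := norm_cfc_le zero_le_one fun s hsp => by
    rw [Real.norm_eq_abs, abs_of_nonneg (resolventExp_nonneg _ _)]
    exact resolventExp_le_one ht (hs hsp)
  have h2 : ‖cfc (resolventExp t) R (R h) - R h‖ ≤ t * ‖h‖ := by
    have h3 : cfc (fun s => resolventExp t s * s - s) R = cfc (resolventExp t) R * R - R := by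
      rw [cfc_sub (f := fun s => resolventExp t s * s) (g := fun s => s)
          (hf := (hc2 t).mul continuousOn_id) (hg := continuousOn_id),
        cfc_mul (f := resolventExp t) (g := fun s => s) (hf := hc2 t) (hg := continuousOn_id),
        cfc_id' ℝ R]
    have h4 : cfc (resolventExp t) R (R h) - R h
        = cfc (fun s => resolventExp t s * s - s) R h := by rw [h3]; rfl
    rw [h4]
    refine (ContinuousLinearMap.le_opNorm _ _).trans ?_
    gcongr
    exact norm_cfc_le ht.le fun s hsp => abs_resolventExp_mul_sub_le ht (hs hsp)
  rw [dist_eq_norm] at hh ⊢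
  calc ‖cfc (resolventExp t) R g - g‖
      = ‖cfc (resolventExp t) R (g - R h) + (cfc (resolventExp t) R (R h) - R h)
          - (g - R h)‖ := by rw [map_sub]; congr 1; abel
    _ ≤ ‖cfc (resolventExp t) R (g - R h)‖ + ‖cfc (resolventExp t) R (R h) - R h‖
          + ‖g - R h‖ := (norm_sub_le _ _).trans (by gcongr; exact norm_add_le _ _)
    _ ≤ 1 * ‖g - R h‖ + t * ‖h‖ + ‖g - R h‖ := by
        gcongr
        exact ContinuousLinearMap.le_of_opNorm_le _ hn _
    _ < δ := by linarith

/-- The heat equation `u' = -(A + W) u`, for a self-adjoint operator `A` and a bounded self-adjoint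
`W` such that `A + W ≥ 0`, is solvable for all initial data. -/
theorem exists_heat_solution_of_nonneg {A : H →ₗ.[ℂ] H} (hA : IsSelfAdjoint A) (W : H →L[ℂ] H)
    (hW : ∀ x y, inner ℂ (W x) y = inner ℂ x (W y))
    (hpos : ∀ x y, (x, y) ∈ A.graph → 0 ≤ (inner ℂ (y + W x) x).re) (g : H) :
    ∃ u : ℝ → H, ContinuousOn u (Ici 0) ∧ u 0 = g ∧
      ∀ t, 0 < t → ∃ v, (u t, v) ∈ A.graph ∧ HasDerivAt u (-(v + W (u t))) t := by
  obtain ⟨R, hR, hR0, hR1, hRd, hgr⟩ := exists_resolvent hA W hW hpos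
  have hs := spectrum_subset_Icc hR hR0 hR1
  -- The value at `0` is set by hand: `resolventExp 0` is the zero function because `0⁻¹ = 0`.
  let u : ℝ → H := fun t => if t ≤ 0 then g else cfc (resolventExp t) R g
  have hu0 : u 0 = g := if_pos le_rfl
  have hut : ∀ t, 0 < t → u t = cfc (resolventExp t) R g := fun t ht => if_neg (not_le.2 ht)
  have key : ∀ t, 0 < t → ∃ v, (u t, v) ∈ A.graph ∧ HasDerivAt u (-(v + W (u t))) t := by
    intro t ht
    have h1 : u t = R (cfc (fun s => s⁻¹ * resolventExp t s) R g) := by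
      rw [hut t ht]
      have h2 : cfc (resolventExp t) R = R * cfc (fun s => s⁻¹ * resolventExp t s) R := by
        conv_rhs => enter [1]; rw [← cfc_id' ℝ R]
        rw [← cfc_mul (f := fun s => s) (g := fun s => s⁻¹ * resolventExp t s)
          (hf := continuousOn_id) (hg := (continuous_inv_mul_resolventExp ht).continuousOn)]
        simp only [mul_inv_mul_resolventExp]
      rw [h2]; rfl
    -- With `u = R h`, the graph relation of `R` gives `A u + W u = h - u`, which is minus the
    -- derivative found by the functional calculus.
    refine ⟨_, h1 ▸ hgr (cfc (fun s => s⁻¹ * resolventExp t s) R g), ?_⟩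
    have h3 := ((ContinuousLinearMap.apply ℂ H g).restrictScalars ℝ).hasFDerivAt.comp_hasDerivAt t
      (hasDerivAt_cfc_resolventExp hR hs ht)
    have h4 : HasDerivAt u (-(cfc (fun s => s⁻¹ * resolventExp t s) R
        - cfc (resolventExp t) R) g) t := by
      refine HasDerivAt.congr_of_eventuallyEq h3 ?_
      filter_upwards [Ioi_mem_nhds ht] with t' ht'
      exact hut t' ht'
    refine h4.congr_deriv ?_
    rw [sub_apply, ← hut t ht, sub_add_cancel]
  refine ⟨u, ?_, hu0, key⟩
  intro t ht
  rcases (mem_Ici.1 ht).eq_or_lt with rfl | h0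
  · rw [← Ioi_insert, continuousWithinAt_insert_self, ContinuousWithinAt, hu0]
    refine (tendsto_cfc_resolventExp hR hs hRd g).congr' ?_
    filter_upwards [self_mem_nhdsWithin] with t' ht'
    exact (hut t' ht').symm
  · obtain ⟨v, -, hv⟩ := key t h0
    exact hv.continuousAt.continuousWithinAt

/-- Replacing `W` by `W + ‖W‖` makes the sum with `A` non-negative; the factor `e^{‖W‖t}` undoes the
shift. -/
theorem exists_heat_solution {A : H →ₗ.[ℂ] H} (hA : IsSelfAdjoint A)
    (hA0 : ∀ x y, (x, y) ∈ A.graph → 0 ≤ (inner ℂ y x).re) (W : H →L[ℂ] H)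
    (hW : ∀ x y, inner ℂ (W x) y = inner ℂ x (W y)) (g : H) :
    ∃ u : ℝ → H, ContinuousOn u (Ici 0) ∧ u 0 = g ∧
      ∀ t, 0 < t → ∃ v, (u t, v) ∈ A.graph ∧ HasDerivAt u (-(v + W (u t))) t := by
  obtain ⟨u, hu, hu0, hut⟩ := exists_heat_solution_of_nonneg hA (W + ((‖W‖ : ℝ) : ℂ) • 1)
    (fun x y => by simp [hW])
    (fun x y hxy => by
      have h1 := hA0 x y hxy
      have h2 : -(‖W‖ * ‖x‖ ^ 2) ≤ (inner ℂ (W x) x).re := by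
        have h3 := (Complex.abs_re_le_norm _).trans (norm_inner_le_norm (𝕜 := ℂ) (W x) x)
        have h4 := (abs_le.1 h3).1
        have h5 : ‖W x‖ * ‖x‖ ≤ ‖W‖ * ‖x‖ * ‖x‖ := by gcongr; exact W.le_opNorm x
        nlinarith
      have h6 := inner_self_eq_norm_sq (𝕜 := ℂ) x
      simp only [RCLike.re_to_complex] at h6
      simp only [add_apply, smul_apply,
        one_apply_eq_self, inner_add_left, inner_smul_left, Complex.add_re,
        Complex.conj_ofReal, Complex.re_ofReal_mul, h6]
      linarith) g
  refine ⟨fun t => Real.exp (‖W‖ * t) • u t, ?_, by simp [hu0], fun t ht => ?_⟩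
  · have h1 : ContinuousOn (fun t => Real.exp (‖W‖ * t)) (Ici 0) := by fun_prop
    exact h1.smul hu
  · obtain ⟨v, hv, hd⟩ := hut t ht
    refine ⟨Real.exp (‖W‖ * t) • v, ?_, ?_⟩
    · have := A.graph.smul_mem ((Real.exp (‖W‖ * t) : ℝ) : ℂ) hv
      change (((Real.exp (‖W‖ * t) : ℝ) : ℂ) • u t, ((Real.exp (‖W‖ * t) : ℝ) : ℂ) • v) ∈ _ at this
      rwa [Complex.coe_smul, Complex.coe_smul] at this
    · have h1 : HasDerivAt (fun t => Real.exp (‖W‖ * t)) (Real.exp (‖W‖ * t) * ‖W‖) t := by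
        simpa using ((hasDerivAt_id t).const_mul ‖W‖).exp
      refine (h1.smul hd).congr_deriv ?_
      simp only [add_apply, smul_apply,
        one_apply_eq_self, Complex.coe_smul, ContinuousLinearMap.map_smul_of_tower]
      module

end Semigroup

/-! ### Gronwall's inequality for the energy -/

section Energy

variable {H : Type*} [NormedAddCommGroup H] [InnerProductSpace ℂ H]

/-- Energy estimate: if `d/dt ‖w‖² ≤ C (‖w‖² + b)` then `‖w‖² + b` grows at most like `e^{Ct}`. -/
theorem norm_sq_add_le_of_hasDerivWithinAt {w : ℝ → H} {T C b : ℝ} (hw : ContinuousOn w (Icc 0 T))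
    (hd : ∀ t ∈ Ioc 0 T, ∃ w', HasDerivWithinAt w w' (Icc 0 T) t ∧
      2 * (inner ℂ (w t) w').re ≤ C * (‖w t‖ ^ 2 + b)) {t : ℝ} (ht : t ∈ Icc 0 T) :
    ‖w t‖ ^ 2 + b ≤ Real.exp (C * t) * (‖w 0‖ ^ 2 + b) := by
  let : InnerProductSpace ℝ H := InnerProductSpace.rclikeToReal ℂ H
  have hder : ∀ t ∈ Ioo 0 T, ∃ w', 2 * (inner ℂ (w t) w').re ≤ C * (‖w t‖ ^ 2 + b) ∧
      HasDerivAt (fun t => Real.exp (-(C * t)) * (‖w t‖ ^ 2 + b))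
        (Real.exp (-(C * t)) * (-C) * (‖w t‖ ^ 2 + b)
          + Real.exp (-(C * t)) * (2 * (inner ℂ (w t) w').re)) t := by
    intro t ht
    obtain ⟨w', h1, h2⟩ := hd t ⟨ht.1, ht.2.le⟩
    refine ⟨w', h2, ?_⟩
    have h3 : HasDerivAt w w' t := h1.hasDerivAt (Icc_mem_nhds ht.1 ht.2)
    have h4 := h3.norm_sq
    have h5 : HasDerivAt (fun t => Real.exp (-(C * t))) (Real.exp (-(C * t)) * (-C)) t := by
      simpa using ((hasDerivAt_id t).const_mul C).neg.exp
    exact h5.mul (h4.add_const b)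
  -- The integrating factor `e^{-Ct}` makes the energy decrease; derivatives in the interior and
  -- continuity up to the endpoints suffice.
  have hanti : AntitoneOn (fun t => Real.exp (-(C * t)) * (‖w t‖ ^ 2 + b)) (Icc 0 T) := by
    refine antitoneOn_of_deriv_nonpos (convex_Icc 0 T) ?_ ?_ ?_
    · exact ContinuousOn.mul (by fun_prop) ((hw.norm.pow 2).add continuousOn_const)
    · rw [interior_Icc]
      intro t ht
      obtain ⟨w', -, h⟩ := hder t ht
      exact h.differentiableAt.differentiableWithinAt
    · rw [interior_Icc]
      intro t ht
      obtain ⟨w', h1, h⟩ := hder t ht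
      rw [h.deriv]
      nlinarith [mul_le_mul_of_nonneg_left h1 (Real.exp_pos (-(C * t))).le]
  have h := hanti (left_mem_Icc.2 (ht.1.trans ht.2)) ht ht.1
  simp only [mul_zero, neg_zero, Real.exp_zero, one_mul] at h
  calc ‖w t‖ ^ 2 + b = Real.exp (C * t) * (Real.exp (-(C * t)) * (‖w t‖ ^ 2 + b)) := by
        rw [← mul_assoc, ← Real.exp_add]; simp
    _ ≤ _ := by gcongr

end Energy

/-! ### Group law, dilations and invariance of Lebesgue measure -/

namespace GradedLieGroup

variable {n : ℕ} (G : GradedLieGroup n)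

theorem zero_mul (x : Fin n → ℝ) : G.mul 0 x = x := by
  simpa using G.mul_smul_smul 0 1 x

theorem mul_zero (x : Fin n → ℝ) : G.mul x 0 = x := by
  simpa using G.mul_smul_smul 1 0 x

theorem neg_mul_self (x : Fin n → ℝ) : G.mul (-x) x = 0 := by
  simpa using G.mul_smul_smul (-1) 1 x

theorem mul_neg_self (x : Fin n → ℝ) : G.mul x (-x) = 0 := by
  simpa using G.mul_smul_smul 1 (-1) x

theorem neg_mul_cancel_left (x y : Fin n → ℝ) : G.mul (-x) (G.mul x y) = y := by
  rw [← G.mul_assoc, neg_mul_self, zero_mul]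

theorem mul_neg_cancel_left (x y : Fin n → ℝ) : G.mul x (G.mul (-x) y) = y := by
  rw [← G.mul_assoc, mul_neg_self, zero_mul]

theorem mul_neg_cancel_right (x y : Fin n → ℝ) : G.mul (G.mul x y) (-y) = x := by
  rw [G.mul_assoc, mul_neg_self, mul_zero]

theorem neg_mul_cancel_right (x y : Fin n → ℝ) : G.mul (G.mul x (-y)) y = x := by
  rw [G.mul_assoc, neg_mul_self, mul_zero]

theorem continuous_mul : Continuous fun p : (Fin n → ℝ) × (Fin n → ℝ) => G.mul p.1 p.2 :=
  G.contDiff_mul.continuous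

@[fun_prop]
theorem _root_.Continuous.gradedMul {X : Type*} [TopologicalSpace X] {f g : X → Fin n → ℝ}
    (hf : Continuous f) (hg : Continuous g) : Continuous fun x => G.mul (f x) (g x) :=
  G.continuous_mul.comp (hf.prodMk hg)

theorem continuous_dilation_left (x : Fin n → ℝ) : Continuous fun r => G.dilation r x := by
  unfold dilation
  fun_prop

theorem continuous_dilation (r : ℝ) : Continuous (G.dilation r) := by
  unfold dilation
  fun_prop

theorem dilation_zero (x : Fin n → ℝ) : G.dilation 0 x = 0 := by
  ext j
  simp [dilation, (G.weight_pos j).ne']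

theorem dilation_dilation_inv {r : ℝ} (hr : r ≠ 0) (x : Fin n → ℝ) :
    G.dilation r (G.dilation r⁻¹ x) = x := by
  ext j
  simp only [dilation, inv_pow]
  field_simp

/-- The dilation `D_r` as a linear map. -/
noncomputable def dilationCLM (r : ℝ) : (Fin n → ℝ) →L[ℝ] (Fin n → ℝ) :=
  ContinuousLinearMap.pi fun j => r ^ G.weight j • ContinuousLinearMap.proj j

theorem dilationCLM_apply (r : ℝ) (x : Fin n → ℝ) : G.dilationCLM r x = G.dilation r x := rfl

theorem dilation_single (r : ℝ) (k : Fin n) :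
    G.dilation r (Pi.single k 1) = r ^ G.weight k • Pi.single k 1 := by
  ext j
  rcases eq_or_ne j k with rfl | h
  · simp [dilation]
  · simp [dilation, h]

/-- The differential of the group law is homogeneous. -/
theorem fderiv_mul_dilation {r : ℝ} (hr : 0 < r) (p q : (Fin n → ℝ) × (Fin n → ℝ)) :
    fderiv ℝ (fun p : (Fin n → ℝ) × (Fin n → ℝ) => G.mul p.1 p.2)
        (G.dilation r p.1, G.dilation r p.2) (G.dilation r q.1, G.dilation r q.2)
      = G.dilation r (fderiv ℝ (fun p : (Fin n → ℝ) × (Fin n → ℝ) => G.mul p.1 p.2) p q) := by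
  set m := fun p : (Fin n → ℝ) × (Fin n → ℝ) => G.mul p.1 p.2 with hm
  have hd : Differentiable ℝ m := G.contDiff_mul.differentiable (by simp)
  let D : (Fin n → ℝ) × (Fin n → ℝ) →L[ℝ] (Fin n → ℝ) × (Fin n → ℝ) :=
    (G.dilationCLM r).prodMap (G.dilationCLM r)
  have h1 : m ∘ D = G.dilationCLM r ∘ m := by
    ext1 p
    exact (G.mul_dilation r hr p.1 p.2).symm
  have h2 : HasFDerivAt (m ∘ D) ((fderiv ℝ m (D p)).comp D) p :=
    (hd (D p)).hasFDerivAt.comp p D.hasFDerivAt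
  have h3 : HasFDerivAt (G.dilationCLM r ∘ m) ((G.dilationCLM r).comp (fderiv ℝ m p)) p :=
    (G.dilationCLM r).hasFDerivAt.comp p (hd p).hasFDerivAt
  rw [h1] at h2
  exact congrArg (fun L => L q) (h2.unique h3)

/-- A homogeneous partial derivative of the group law: if `q` has degree `ν_k`, the `j`-th component
of `∂_q (x y)` vanishes for `ν_j < ν_k` and is constant for `ν_j = ν_k`. -/
theorem fderiv_mul_component {q : (Fin n → ℝ) × (Fin n → ℝ)} {j k : Fin n}
    (hq : ∀ r : ℝ, (G.dilation r q.1, G.dilation r q.2) = r ^ G.weight k • q)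
    (hjk : G.weight j ≤ G.weight k) (p : (Fin n → ℝ) × (Fin n → ℝ)) :
    fderiv ℝ (fun p : (Fin n → ℝ) × (Fin n → ℝ) => G.mul p.1 p.2) p q j
      = if G.weight j = G.weight k then
          fderiv ℝ (fun p : (Fin n → ℝ) × (Fin n → ℝ) => G.mul p.1 p.2) 0 q j else 0 := by
  set m := fun p : (Fin n → ℝ) × (Fin n → ℝ) => G.mul p.1 p.2 with hm
  have hc : Continuous fun r : ℝ => fderiv ℝ m (G.dilation r p.1, G.dilation r p.2) q j := by
    have h1 : Continuous (fderiv ℝ m) := G.contDiff_mul.continuous_fderiv (by simp)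
    have h2 : Continuous fun r : ℝ => (G.dilation r p.1, G.dilation r p.2) :=
      (G.continuous_dilation_left _).prodMk (G.continuous_dilation_left _)
    exact (continuous_apply j).comp ((h1.comp h2).clm_apply continuous_const)
  -- By homogeneity the value at `p` is `r^{ν_k - ν_j}` times the value at `D_r p`. Letting `r → 0`
  -- moves the base point to the origin and kills the term when `ν_j < ν_k`.
  have h1 : ∀ r : ℝ, 0 < r → fderiv ℝ m p q j
      = r ^ (G.weight k - G.weight j) * fderiv ℝ m (G.dilation r p.1, G.dilation r p.2) q j := by
    intro r hr
    have h2 := congrFun (G.fderiv_mul_dilation hr p q) j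
    rw [hq, map_smul] at h2
    simp only [Pi.smul_apply, smul_eq_mul, dilation] at h2
    rw [← Nat.sub_add_cancel hjk, pow_add] at h2
    have h3 : r ^ G.weight j ≠ 0 := by positivity
    apply mul_left_cancel₀ h3
    rw [← h2]
    ring
  have h2 : Tendsto (fun r : ℝ => r ^ (G.weight k - G.weight j)
      * fderiv ℝ m (G.dilation r p.1, G.dilation r p.2) q j) (𝓝[>] 0)
      (𝓝 (0 ^ (G.weight k - G.weight j)
        * fderiv ℝ m (G.dilation 0 p.1, G.dilation 0 p.2) q j)) :=
    (((continuous_pow _).mul hc).tendsto 0).mono_left nhdsWithin_le_nhds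
  have h3 : Tendsto (fun r : ℝ => r ^ (G.weight k - G.weight j)
      * fderiv ℝ m (G.dilation r p.1, G.dilation r p.2) q j) (𝓝[>] 0) (𝓝 (fderiv ℝ m p q j)) := by
    refine tendsto_const_nhds.congr' ?_
    filter_upwards [self_mem_nhdsWithin] with r hr
    exact h1 r hr
  rw [tendsto_nhds_unique h3 h2, dilation_zero, dilation_zero]
  split_ifs with h
  · rw [h, Nat.sub_self, pow_zero, one_mul]
    rfl
  · rw [zero_pow (Nat.sub_ne_zero_of_lt (lt_of_le_of_ne hjk h)), MulZeroClass.zero_mul]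

/-- Grouping coordinates by weight makes the matrix block triangular with identity diagonal blocks.
Entries vanish for `ν_j < ν_k`, so the blocks are taken in the order dual. -/
theorem det_eq_one_of_weight {L : (Fin n → ℝ) →L[ℝ] (Fin n → ℝ)}
    (hL : ∀ j k, G.weight j ≤ G.weight k →
      L (Pi.single k 1) j = if G.weight j = G.weight k then (Pi.single k 1 : Fin n → ℝ) j else 0) :
    L.det = 1 := by
  change LinearMap.det L.toLinearMap = 1
  rw [← LinearMap.det_toMatrix']
  have hM : (LinearMap.toMatrix' L.toLinearMap).BlockTriangular
      (fun j => OrderDual.toDual (G.weight j)) := by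
    intro j k hjk
    have h : G.weight j < G.weight k := hjk
    rw [LinearMap.toMatrix'_apply]
    exact (hL j k h.le).trans (if_neg h.ne)
  rw [hM.det]
  refine Finset.prod_eq_one fun a _ => ?_
  have h1 : (LinearMap.toMatrix' L.toLinearMap).toSquareBlock
      (fun j => OrderDual.toDual (G.weight j)) a = 1 := by
    ext ⟨j, hj⟩ ⟨k, hk⟩
    have h : G.weight j = G.weight k := OrderDual.toDual.injective (hj.trans hk.symm)
    rw [Matrix.toSquareBlock_def, Matrix.of_apply, LinearMap.toMatrix'_apply, Matrix.one_apply]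
    refine (hL j k h.le).trans ?_
    rw [if_pos h, Pi.single_apply]
    simp [Subtype.ext_iff]
  rw [h1, Matrix.det_one]

theorem measurePreserving_of_det_eq_one {f g : (Fin n → ℝ) → (Fin n → ℝ)}
    {f' : (Fin n → ℝ) → (Fin n → ℝ) →L[ℝ] (Fin n → ℝ)} (hf : ∀ x, HasFDerivAt f (f' x) x)
    (hdet : ∀ x, (f' x).det = 1) (hl : Function.LeftInverse g f) (hr : Function.RightInverse g f) :
    MeasurePreserving f volume volume := by
  have hc : Continuous f := continuous_iff_continuousAt.2 fun x => (hf x).continuousAt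
  refine ⟨hc.measurable, ?_⟩
  have h := map_withDensity_abs_det_fderiv_eq_addHaar (volume : Measure (Fin n → ℝ))
    MeasurableSet.univ.nullMeasurableSet (fun x _ => (hf x).hasFDerivWithinAt) hl.injective.injOn
  simpa [hdet, hr.surjective.range_eq] using h

/-- By `fderiv_mul_component` the differential is block triangular, with diagonal blocks independent
of `a` and `x`. They are read off at `a = 0`, where the translation is the identity. -/
theorem measurePreserving_mul_left (a : Fin n → ℝ) :
    MeasurePreserving (G.mul a) volume volume := by
  have hd := G.contDiff_mul.differentiable (by simp)
  refine measurePreserving_of_det_eq_one (g := G.mul (-a))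
    (f' := fun x => (fderiv ℝ (fun p : (Fin n → ℝ) × (Fin n → ℝ) => G.mul p.1 p.2) (a, x)).comp
      (ContinuousLinearMap.inr ℝ _ _)) (fun x => ?_) (fun x => ?_)
    (G.neg_mul_cancel_left a) (G.mul_neg_cancel_left a)
  · exact (hd (a, x)).hasFDerivAt.comp x (hasFDerivAt_prodMk_right a x)
  · refine G.det_eq_one_of_weight fun j k hjk => ?_
    have h := G.fderiv_mul_component (q := (0, Pi.single k 1)) (j := j) (k := k)
      (fun r => by
        rw [G.dilation_single]
        ext <;> simp [dilation]) hjk (a, x)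
    refine h.trans ?_
    congr 1
    have h1 : HasFDerivAt (fun x => G.mul 0 x) _ 0 :=
      (hd (0, 0)).hasFDerivAt.comp 0 (hasFDerivAt_prodMk_right 0 0)
    simp only [G.zero_mul] at h1
    exact congrArg (fun L : (Fin n → ℝ) →L[ℝ] (Fin n → ℝ) => L (Pi.single k 1) j)
      (h1.unique (hasFDerivAt_id 0))

theorem measurePreserving_mul_right (a : Fin n → ℝ) :
    MeasurePreserving (fun x => G.mul x a) volume volume := by
  have hd := G.contDiff_mul.differentiable (by simp)
  refine measurePreserving_of_det_eq_one (g := fun x => G.mul x (-a))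
    (f' := fun x => (fderiv ℝ (fun p : (Fin n → ℝ) × (Fin n → ℝ) => G.mul p.1 p.2) (x, a)).comp
      (ContinuousLinearMap.inl ℝ _ _)) (fun x => ?_) (fun x => ?_)
    (fun x => G.mul_neg_cancel_right x a) (fun x => G.neg_mul_cancel_right x a)
  · exact (hd (x, a)).hasFDerivAt.comp x (hasFDerivAt_prodMk_left (𝕜 := ℝ) x a)
  · refine G.det_eq_one_of_weight fun j k hjk => ?_
    have h := G.fderiv_mul_component (q := (Pi.single k 1, 0)) (j := j) (k := k)
      (fun r => by
        rw [G.dilation_single]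
        ext <;> simp [dilation]) hjk (x, a)
    refine h.trans ?_
    congr 1
    have h1 : HasFDerivAt (fun x => G.mul x 0) _ 0 :=
      (hd (0, 0)).hasFDerivAt.comp (f := fun x => (x, (0 : Fin n → ℝ))) 0
        (hasFDerivAt_prodMk_left (𝕜 := ℝ) 0 0)
    simp only [G.mul_zero] at h1
    exact congrArg (fun L : (Fin n → ℝ) →L[ℝ] (Fin n → ℝ) => L (Pi.single k 1) j)
      (h1.unique (hasFDerivAt_id 0))

/-- The change of variables `y ↦ y⁻¹ x`. -/
theorem measurePreserving_neg_mul (x : Fin n → ℝ) :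
    MeasurePreserving (fun y => G.mul (-y) x) volume volume :=
  (G.measurePreserving_mul_right x).comp (Measure.measurePreserving_neg volume)

theorem map_dilation {r : ℝ} (hr : 0 < r) :
    Measure.map (G.dilation r) volume
      = ENNReal.ofReal (r ^ G.homDim)⁻¹ • (volume : Measure (Fin n → ℝ)) := by
  have h1 : (G.dilationCLM r).toLinearMap
      = Matrix.toLin' (Matrix.diagonal fun j => r ^ G.weight j) := by
    ext x j
    simp [dilationCLM_apply, dilation, Matrix.mulVec_diagonal]
  have h2 : LinearMap.det (G.dilationCLM r).toLinearMap = r ^ G.homDim := by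
    rw [h1, LinearMap.det_toLin', Matrix.det_diagonal, homDim, Finset.prod_pow_eq_pow_sum]
  have h3 := Measure.map_linearMap_addHaar_eq_smul_addHaar (volume : Measure (Fin n → ℝ))
    (f := (G.dilationCLM r).toLinearMap) (by rw [h2]; positivity)
  rw [h2, abs_of_pos (by positivity)] at h3
  exact h3

theorem integral_rescale {f : (Fin n → ℝ) → ℝ} (hf : Continuous f) {w : ℝ} (hw : 0 < w) :
    ∫ x, G.rescale f w x = ∫ x, f x := by
  unfold rescale
  rw [integral_const_mul, ← integral_map (φ := G.dilation w⁻¹) (f := f)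
    (G.continuous_dilation _).aemeasurable hf.aestronglyMeasurable, G.map_dilation (inv_pos.2 hw),
    integral_smul_measure, ENNReal.toReal_ofReal (by positivity)]
  rw [inv_pow, inv_inv, smul_eq_mul, ← _root_.mul_assoc, inv_mul_cancel₀ (by positivity), one_mul]

theorem norm_rescale (f : (Fin n → ℝ) → ℝ) {w : ℝ} (hw : 0 < w) (x : Fin n → ℝ) :
    ‖G.rescale f w x‖ = G.rescale (fun x => ‖f x‖) w x := by
  unfold rescale
  rw [norm_mul, Real.norm_of_nonneg (by positivity)]

theorem continuous_rescale {f : (Fin n → ℝ) → ℝ} (hf : Continuous f) (w : ℝ) :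
    Continuous (G.rescale f w) := by
  unfold rescale
  exact continuous_const.mul (hf.comp (G.continuous_dilation _))

theorem hasCompactSupport_rescale {f : (Fin n → ℝ) → ℝ} (hf : HasCompactSupport f) {w : ℝ}
    (hw : 0 < w) : HasCompactSupport (G.rescale f w) := by
  refine HasCompactSupport.intro (K := G.dilation w '' tsupport f)
    (hf.isCompact.image (G.continuous_dilation w)) fun x hx => ?_
  have : G.dilation w⁻¹ x ∉ tsupport f := fun h =>
    hx ⟨_, h, G.dilation_dilation_inv hw.ne' x⟩
  rw [rescale, image_eq_zero_of_notMem_tsupport this, MulZeroClass.mul_zero]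

/-- The support of `ψ_w` shrinks to `0` as `w → 0`. -/
theorem eventually_rescale_support {f : (Fin n → ℝ) → ℝ} (hf : HasCompactSupport f) {δ : ℝ}
    (hδ : 0 < δ) : ∀ᶠ w in 𝓝[>] (0 : ℝ), ∀ x, G.rescale f w x ≠ 0 → ‖x‖ < δ := by
  obtain ⟨B, hB⟩ := hf.isCompact.isBounded.exists_norm_le
  have h1 : ∀ᶠ w in 𝓝[>] (0 : ℝ), w * (|B| + 1) < δ := by
    have h2 : Tendsto (fun w : ℝ => w * (|B| + 1)) (𝓝[>] 0) (𝓝 (0 * (|B| + 1))) :=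
      ((continuous_mul_const _).tendsto 0).mono_left nhdsWithin_le_nhds
    rw [MulZeroClass.zero_mul] at h2
    exact h2.eventually_lt_const hδ
  have h2 : ∀ᶠ w in 𝓝[>] (0 : ℝ), w < 1 :=
    (eventually_lt_nhds one_pos).filter_mono nhdsWithin_le_nhds
  filter_upwards [h1, h2, self_mem_nhdsWithin] with w hw1 hw2 hw x hx
  have hw : 0 < w := hw
  have hz : G.dilation w⁻¹ x ∈ tsupport f := by
    by_contra h
    exact hx (by rw [rescale, image_eq_zero_of_notMem_tsupport h, MulZeroClass.mul_zero])
  refine lt_of_le_of_lt ?_ hw1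
  rw [pi_norm_le_iff_of_nonneg (by positivity)]
  intro j
  rw [← G.dilation_dilation_inv hw.ne' x, dilation, norm_mul, norm_pow, Real.norm_of_nonneg hw.le]
  have h3 : ‖G.dilation w⁻¹ x j‖ ≤ |B| + 1 :=
    (norm_le_pi_norm _ j).trans ((hB _ hz).trans ((le_abs_self B).trans (by linarith)))
  -- All weights are at least `1`, so for `w < 1` every coordinate contracts at least by `w`.
  have h4 : w ^ G.weight j ≤ w := by
    simpa using pow_le_pow_of_le_one hw.le hw2.le (G.weight_pos j)
  gcongr

end GradedLieGroup

/-! ### Convolution inequalities and mollification -/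

/-- Cauchy–Schwarz for the measure with density `a`. -/
theorem sq_lintegral_mul_le {α : Type*} [MeasurableSpace α] {μ : Measure α} {a b : α → ENNReal}
    (ha : AEMeasurable a μ) (hb : AEMeasurable b μ) :
    (∫⁻ x, a x * b x ∂μ) ^ 2 ≤ (∫⁻ x, a x ∂μ) * ∫⁻ x, a x * b x ^ 2 ∂μ := by
  have hroot : ∀ c : ENNReal, (c ^ (1 / 2 : ℝ)) ^ 2 = c := fun c => by
    rw [← ENNReal.rpow_natCast, ← ENNReal.rpow_mul]; norm_num
  have h := ENNReal.lintegral_mul_le_Lp_mul_Lq μ Real.HolderConjugate.two_two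
    (ha.pow_const (1 / 2 : ℝ)) ((ha.pow_const (1 / 2 : ℝ)).mul hb)
  simp only [Pi.mul_apply, ← mul_assoc, ENNReal.rpow_two, mul_pow, hroot] at h
  simp only [← sq, hroot] at h
  refine (pow_le_pow_left' h 2).trans_eq ?_
  rw [mul_pow, hroot, hroot]

theorem eLpNorm_two_sq {α F : Type*} [MeasurableSpace α] {μ : Measure α} [NormedAddCommGroup F]
    (f : α → F) : eLpNorm f 2 μ ^ 2 = ∫⁻ x, ‖f x‖ₑ ^ 2 ∂μ := by
  have h := eLpNorm_nnreal_pow_eq_lintegral (f := f) (μ := μ) (p := 2) two_ne_zero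
  simpa using h

namespace GradedLieGroup

variable {n : ℕ} (G : GradedLieGroup n) {F : Type*} [NormedAddCommGroup F]

/-- A continuous function vanishing at infinity is uniformly continuous on the group. -/
theorem exists_forall_norm_mul_sub_le {f : (Fin n → ℝ) → F} (hf : Continuous f)
    (h0 : Tendsto f (cocompact _) (𝓝 0)) {δ : ℝ} (hδ : 0 < δ) :
    ∃ r > 0, ∀ h, ‖h‖ < r → ∀ x, ‖f (G.mul x h) - f x‖ ≤ δ := by
  have h1 : ∀ᶠ x in cocompact (Fin n → ℝ), ‖f x‖ < δ / 2 := by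
    have := h0.norm
    rw [norm_zero] at this
    exact this.eventually_lt_const (half_pos hδ)
  obtain ⟨L, hL, hLs⟩ := mem_cocompact.1 h1
  -- If `x ∉ K` and `‖h‖ ≤ 1`, then both `x` and `xh` avoid `L`, where `f` is small; on the compact
  -- `K` continuity is uniform.
  let K := L ∪ (fun p : (Fin n → ℝ) × (Fin n → ℝ) => G.mul p.1 (-p.2)) '' (L ×ˢ Metric.closedBall 0 1)
  have hK : IsCompact K :=
    hL.union ((hL.prod (isCompact_closedBall 0 1)).image (by fun_prop))
  have h2 : Continuous fun p : (Fin n → ℝ) × (Fin n → ℝ) => f (G.mul p.2 p.1) - f p.2 := by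
    fun_prop
  have h3 : ∀ᶠ h in 𝓝 (0 : Fin n → ℝ), ∀ x ∈ K, ‖f (G.mul x h) - f x‖ < δ := by
    refine hK.eventually_forall_of_forall_eventually fun x _ => ?_
    have h4 := h2.norm.tendsto (0, x)
    simp only [mul_zero, sub_self, norm_zero] at h4
    exact h4.eventually_lt_const hδ
  obtain ⟨r, hr, hball⟩ := Metric.eventually_nhds_iff.1 h3
  refine ⟨min r 1, lt_min hr one_pos, fun h hh x => ?_⟩
  by_cases hx : x ∈ K
  · exact (hball (by rw [dist_zero_right]; exact hh.trans_le (min_le_left _ _)) x hx).le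
  · have hx1 : x ∉ L := fun h => hx (Or.inl h)
    have hx2 : G.mul x h ∉ L := fun hm => hx (Or.inr ⟨(_, h), ⟨hm, by
      rw [mem_closedBall_zero_iff]; exact (hh.trans_le (min_le_right _ _)).le⟩,
      G.mul_neg_cancel_right x h⟩)
    have e1 : ‖f x‖ < δ / 2 := hLs hx1
    have e2 : ‖f (G.mul x h)‖ < δ / 2 := hLs hx2
    exact (norm_sub_le _ _).trans (by linarith)

variable [NormedSpace ℝ F]

theorem aestronglyMeasurable_conv {f : (Fin n → ℝ) → F} {k : (Fin n → ℝ) → ℝ}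
    (hf : AEStronglyMeasurable f volume) (hk : Continuous k) :
    AEStronglyMeasurable (G.conv f k) volume := by
  have h1 : Continuous fun p : (Fin n → ℝ) × (Fin n → ℝ) => k (G.mul (-p.2) p.1) := by fun_prop
  exact (h1.aestronglyMeasurable.smul hf.comp_snd).integral_prod_right'

/-- **Young's inequality** for `L² * L¹`. -/
theorem eLpNorm_conv_le {f : (Fin n → ℝ) → F} {k : (Fin n → ℝ) → ℝ}
    (hf : AEStronglyMeasurable f volume) (hk : Continuous k) :
    eLpNorm (G.conv f k) 2 volume ≤ (∫⁻ x, ‖k x‖ₑ) * eLpNorm f 2 volume := by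
  have hkm : Measurable fun x => ‖k x‖ₑ := hk.enorm.measurable
  have h1 : ∀ x, ∫⁻ y, ‖k (G.mul (-y) x)‖ₑ = ∫⁻ y, ‖k y‖ₑ := fun x =>
    (G.measurePreserving_neg_mul x).lintegral_comp hkm
  have h2 : ∀ y, ∫⁻ x, ‖k (G.mul (-y) x)‖ₑ = ∫⁻ y, ‖k y‖ₑ := fun y =>
    (G.measurePreserving_mul_left (-y)).lintegral_comp hkm
  have hc : Continuous fun p : (Fin n → ℝ) × (Fin n → ℝ) => ‖k (G.mul (-p.2) p.1)‖ₑ := by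
    have : Continuous fun p : (Fin n → ℝ) × (Fin n → ℝ) => k (G.mul (-p.2) p.1) := by fun_prop
    exact this.enorm
  have hcx : ∀ x, AEMeasurable (fun y => ‖k (G.mul (-y) x)‖ₑ) volume := fun x =>
    (hc.comp (Continuous.prodMk_right x)).measurable.aemeasurable
  -- Cauchy–Schwarz for the measure `|k(y⁻¹x)| dy`, whose mass is `‖k‖₁` for every `x`; integrating
  -- in `x` and exchanging the integrals gives the second factor `‖k‖₁`.
  have h3 : ∀ x, ‖G.conv f k x‖ₑ ^ 2
      ≤ (∫⁻ y, ‖k y‖ₑ) * ∫⁻ y, ‖k (G.mul (-y) x)‖ₑ * ‖f y‖ₑ ^ 2 := by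
    intro x
    have h4 : ‖G.conv f k x‖ₑ ≤ ∫⁻ y, ‖k (G.mul (-y) x)‖ₑ * ‖f y‖ₑ := by
      refine (enorm_integral_le_lintegral_enorm _).trans_eq ?_
      simp only [enorm_smul]
    calc ‖G.conv f k x‖ₑ ^ 2 ≤ (∫⁻ y, ‖k (G.mul (-y) x)‖ₑ * ‖f y‖ₑ) ^ 2 := by gcongr
      _ ≤ _ := sq_lintegral_mul_le (hcx x) hf.enorm
      _ = _ := by rw [h1 x]
  rw [← ENNReal.pow_le_pow_left_iff two_ne_zero, mul_pow, eLpNorm_two_sq, eLpNorm_two_sq]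
  calc ∫⁻ x, ‖G.conv f k x‖ₑ ^ 2
      ≤ ∫⁻ x, (∫⁻ y, ‖k y‖ₑ) * ∫⁻ y, ‖k (G.mul (-y) x)‖ₑ * ‖f y‖ₑ ^ 2 := lintegral_mono h3
    _ ≤ (∫⁻ y, ‖k y‖ₑ) * ∫⁻ x, ∫⁻ y, ‖k (G.mul (-y) x)‖ₑ * ‖f y‖ₑ ^ 2 := by
        refine (lintegral_const_mul'' _ ?_).le
        exact AEMeasurable.lintegral_prod_right' (f := fun p : (Fin n → ℝ) × (Fin n → ℝ) =>
          ‖k (G.mul (-p.2) p.1)‖ₑ * ‖f p.2‖ₑ ^ 2)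
          (hc.measurable.aemeasurable.mul (hf.enorm.pow_const 2).comp_snd)
    _ = (∫⁻ y, ‖k y‖ₑ) * ∫⁻ y, ∫⁻ x, ‖k (G.mul (-y) x)‖ₑ * ‖f y‖ₑ ^ 2 := by
        rw [lintegral_lintegral_swap]
        exact hc.measurable.aemeasurable.mul (hf.enorm.pow_const 2).comp_snd
    _ = (∫⁻ y, ‖k y‖ₑ) * ∫⁻ y, (∫⁻ y, ‖k y‖ₑ) * ‖f y‖ₑ ^ 2 := by
        congr 1
        refine lintegral_congr fun y => ?_
        have h5 : Measurable fun x => ‖k (G.mul (-y) x)‖ₑ :=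
          (hc.comp (Continuous.prodMk_left y)).measurable
        rw [lintegral_mul_const _ h5, h2]
    _ = (∫⁻ x, ‖k x‖ₑ) ^ 2 * ∫⁻ x, ‖f x‖ₑ ^ 2 := by
        rw [lintegral_const_mul'' _ (hf.enorm.pow_const 2)]
        ring

theorem lintegral_enorm_rescale {k : (Fin n → ℝ) → ℝ} (hk : Continuous k)
    (hc : HasCompactSupport k) {w : ℝ} (hw : 0 < w) :
    ∫⁻ x, ‖G.rescale k w x‖ₑ = ENNReal.ofReal (∫ x, ‖k x‖) := by
  rw [← G.integral_rescale hk.norm hw]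
  simp only [← G.norm_rescale k hw]
  rw [ofReal_integral_norm_eq_lintegral_enorm]
  exact (G.continuous_rescale hk w).integrable_of_hasCompactSupport
    (G.hasCompactSupport_rescale hc hw)

theorem memLp_conv {f : (Fin n → ℝ) → F} (hf : MemLp f 2 volume) {k : (Fin n → ℝ) → ℝ}
    (hk : Continuous k) (hc : HasCompactSupport k) : MemLp (G.conv f k) 2 volume := by
  refine ⟨G.aestronglyMeasurable_conv hf.1 hk, (G.eLpNorm_conv_le hf.1 hk).trans_lt ?_⟩
  exact ENNReal.mul_lt_top (hk.integrable_of_hasCompactSupport hc).2 hf.2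

theorem hasCompactSupport_comp_neg_mul {k : (Fin n → ℝ) → ℝ} (hc : HasCompactSupport k)
    (x : Fin n → ℝ) : HasCompactSupport fun y => k (G.mul (-y) x) := by
  refine HasCompactSupport.intro (K := (fun z => G.mul x (-z)) '' tsupport k)
    (hc.isCompact.image (by fun_prop)) fun y hy => ?_
  refine image_eq_zero_of_notMem_tsupport fun h => hy ⟨_, h, ?_⟩
  have h1 := G.mul_neg_cancel_left y x
  change G.mul x (-(G.mul (-y) x)) = y
  nth_rewrite 1 [← h1]
  exact G.mul_neg_cancel_right _ _

theorem integrable_conv_integrand {f : (Fin n → ℝ) → F} (hf : MemLp f 2 volume)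
    {k : (Fin n → ℝ) → ℝ} (hk : Continuous k) (hc : HasCompactSupport k) (x : Fin n → ℝ) :
    Integrable (fun y => k (G.mul (-y) x) • f y) volume := by
  have h1 : Continuous fun y => k (G.mul (-y) x) := by fun_prop
  have h2 : MemLp (fun y => k (G.mul (-y) x)) 2 volume :=
    h1.memLp_of_hasCompactSupport (G.hasCompactSupport_comp_neg_mul hc x)
  exact memLp_one_iff_integrable.1 (hf.smul h2)

theorem conv_sub {f g : (Fin n → ℝ) → F} (hf : MemLp f 2 volume) (hg : MemLp g 2 volume)
    {k : (Fin n → ℝ) → ℝ} (hk : Continuous k) (hc : HasCompactSupport k) :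
    G.conv (f - g) k = G.conv f k - G.conv g k := by
  ext x
  simp only [conv, Pi.sub_apply, smul_sub]
  exact integral_sub (G.integrable_conv_integrand hf hk hc x) (G.integrable_conv_integrand hg hk hc x)

theorem integral_comp_neg_mul {k : (Fin n → ℝ) → ℝ} (hk : Continuous k) (x : Fin n → ℝ) :
    ∫ y, k (G.mul (-y) x) = ∫ y, k y := by
  have h := integral_map (μ := volume) (G.measurePreserving_neg_mul x).aemeasurable (f := k)
    hk.aestronglyMeasurable
  rw [(G.measurePreserving_neg_mul x).map_eq] at h
  exact h.symm

theorem norm_conv_le {f : (Fin n → ℝ) → F} {M : ℝ} (hf : ∀ x, ‖f x‖ ≤ M)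
    {k : (Fin n → ℝ) → ℝ} (hk : Continuous k) (hc : HasCompactSupport k) (x : Fin n → ℝ) :
    ‖G.conv f k x‖ ≤ (∫ y, ‖k y‖) * M := by
  have hcx : Continuous fun y => k (G.mul (-y) x) := by fun_prop
  rw [← G.integral_comp_neg_mul hk.norm x, ← integral_mul_const]
  refine norm_integral_le_of_norm_le
    ((hcx.integrable_of_hasCompactSupport (G.hasCompactSupport_comp_neg_mul hc x)).norm.mul_const _)
    (Eventually.of_forall fun y => ?_)
  rw [norm_smul]
  gcongr
  exact hf y

variable [CompleteSpace F]

/-- Mollification of a continuous function vanishing at infinity converges uniformly. -/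
theorem eventually_norm_conv_rescale_sub_le {f : (Fin n → ℝ) → F} (hf : Continuous f)
    (h0 : Tendsto f (cocompact _) (𝓝 0)) {k : (Fin n → ℝ) → ℝ} (hk : IsMollifier k) {δ : ℝ}
    (hδ : 0 < δ) : ∀ᶠ w in 𝓝[>] (0 : ℝ), ∀ x, ‖G.conv f (G.rescale k w) x - f x‖ ≤ δ := by
  have hkc := hk.contDiff.continuous
  -- The mollifier may change sign, so the oscillation of `f` gets multiplied by its `L¹` norm,
  -- which scaling preserves.
  set C := ∫ x, ‖k x‖ with hC
  have hC0 : 0 ≤ C := integral_nonneg fun _ => norm_nonneg _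
  obtain ⟨r, hr, hunif⟩ := G.exists_forall_norm_mul_sub_le hf h0
    (show 0 < δ / (C + 1) by positivity)
  filter_upwards [G.eventually_rescale_support hk.hasCompactSupport hr, self_mem_nhdsWithin]
    with w hw hw0 x
  have hw0 : 0 < w := hw0
  have hwc := G.continuous_rescale hkc w
  have hws := G.hasCompactSupport_rescale hk.hasCompactSupport hw0
  have hcx : Continuous fun y => G.rescale k w (G.mul (-y) x) := by fun_prop
  have hsx := G.hasCompactSupport_comp_neg_mul hws x
  have h1 : ∫ y, G.rescale k w (G.mul (-y) x) = 1 := by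
    rw [G.integral_comp_neg_mul hwc, G.integral_rescale hkc hw0, hk.integral_eq_one]
  have h2 : ∫ y, ‖G.rescale k w (G.mul (-y) x)‖ = C := by
    rw [G.integral_comp_neg_mul hwc.norm]
    simp only [G.norm_rescale k hw0]
    exact G.integral_rescale hkc.norm hw0
  -- Unit mass allows `f x` under the integral. On the support `y` is close to `x`, as `y = x
  -- (y⁻¹x)⁻¹`.
  have h3 : G.conv f (G.rescale k w) x - f x
      = ∫ y, G.rescale k w (G.mul (-y) x) • (f y - f x) := by
    have e1 : Integrable (fun y => G.rescale k w (G.mul (-y) x) • f y) volume :=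
      (hcx.smul hf).integrable_of_hasCompactSupport hsx.smul_right
    have e2 : Integrable (fun y => G.rescale k w (G.mul (-y) x) • f x) volume :=
      (hcx.smul continuous_const).integrable_of_hasCompactSupport hsx.smul_right
    simp only [smul_sub]
    rw [integral_sub e1 e2, integral_smul_const, h1, one_smul, conv]
  have h4 : ∀ y, ‖G.rescale k w (G.mul (-y) x) • (f y - f x)‖
      ≤ ‖G.rescale k w (G.mul (-y) x)‖ * (δ / (C + 1)) := by
    intro y
    rw [norm_smul]
    by_cases hz : G.rescale k w (G.mul (-y) x) = 0
    · simp [hz]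
    · gcongr
      have h5 := hunif (-(G.mul (-y) x)) (by rw [norm_neg]; exact hw _ hz) x
      have h6 : G.mul x (-(G.mul (-y) x)) = y := by
        nth_rewrite 1 [← G.mul_neg_cancel_left y x]
        exact G.mul_neg_cancel_right _ _
      rwa [h6] at h5
  rw [h3]
  calc ‖∫ y, G.rescale k w (G.mul (-y) x) • (f y - f x)‖
      ≤ ∫ y, ‖G.rescale k w (G.mul (-y) x)‖ * (δ / (C + 1)) :=
        norm_integral_le_of_norm_le
          ((hcx.integrable_of_hasCompactSupport hsx).norm.mul_const _) (Eventually.of_forall h4)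
    _ = C * (δ / (C + 1)) := by rw [integral_mul_const, h2]
    _ ≤ δ := by
        rw [mul_div_assoc', div_le_iff₀ (by positivity)]
        nlinarith

/-- Approximate `f` in `L²` by `g` continuous with compact support. Young's inequality costs `C δ'`
for `f - g`, and the errors of `g` and of `f - g` itself cost `δ'` each, whence `C + 2`. -/
theorem eventually_eLpNorm_conv_rescale_sub_le {f : (Fin n → ℝ) → F} (hf : MemLp f 2 volume)
    {k : (Fin n → ℝ) → ℝ} (hk : IsMollifier k) {δ : ENNReal} (hδ : 0 < δ) :
    ∀ᶠ w in 𝓝[>] (0 : ℝ), eLpNorm (G.conv f (G.rescale k w) - f) 2 volume ≤ δ := by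
  have hkc := hk.contDiff.continuous
  set C : ENNReal := ENNReal.ofReal (∫ x, ‖k x‖) with hC
  have hC1 : C + 2 ≠ 0 := by simp
  have hC2 : C + 2 ≠ ⊤ := by simp [hC]
  obtain ⟨δ', hδ'0, hδ'⟩ : ∃ δ' : NNReal, 0 < δ' ∧ (C + 2) * δ' ≤ δ := by
    obtain ⟨d, hd0, hd⟩ := ENNReal.lt_iff_exists_nnreal_btwn.1 (ENNReal.div_pos hδ.ne' hC2)
    refine ⟨d, by exact_mod_cast hd0, ?_⟩
    calc (C + 2) * d ≤ (C + 2) * (δ / (C + 2)) := by gcongr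
      _ ≤ δ := ENNReal.mul_div_le
  obtain ⟨g, hgs, hgn, hgc, hgL⟩ := hf.exists_hasCompactSupport_eLpNorm_sub_le
    (by simp) (ε := δ') (by exact_mod_cast hδ'0.ne')
  have hgu : ∀ᶠ w in 𝓝[>] (0 : ℝ), eLpNorm (G.conv g (G.rescale k w) - g) 2 volume ≤ δ' := by
    -- Once `ψ_w` is supported in the unit ball, `g * ψ_w` and `g` both vanish off `K`. Uniform
    -- convergence then gives `L²` convergence, at the price of `b = |K|^{1/2}`.
    let K := (fun p : (Fin n → ℝ) × (Fin n → ℝ) => G.mul p.1 p.2) ''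
      (tsupport g ×ˢ Metric.closedBall 0 1)
    have hK : IsCompact K := (hgs.isCompact.prod (isCompact_closedBall 0 1)).image (by fun_prop)
    have hgK : ∀ x ∉ K, g x = 0 := fun x hx => image_eq_zero_of_notMem_tsupport fun h =>
      hx ⟨(x, 0), ⟨h, by simp⟩, G.mul_zero x⟩
    set b := volume.real K ^ (1 / 2 : ℝ) with hb
    have hb0 : 0 ≤ b := by positivity
    have hd : 0 < (δ' : ℝ) / (b + 1) := by have : (0 : ℝ) < δ' := hδ'0; positivity
    filter_upwards [G.eventually_norm_conv_rescale_sub_le hgc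
      hgs.is_zero_at_infty hk hd, G.eventually_rescale_support hk.hasCompactSupport one_pos]
      with w hw1 hw2
    have h1 : ∀ x, ‖(G.conv g (G.rescale k w) - g) x‖
        ≤ K.indicator (fun _ => (δ' : ℝ) / (b + 1)) x := by
      intro x
      by_cases hx : x ∈ K
      · rw [indicator_of_mem hx]; exact hw1 x
      · rw [indicator_of_notMem hx, Pi.sub_apply, hgK x hx, sub_zero, norm_le_zero_iff, conv]
        refine integral_eq_zero_of_ae (Eventually.of_forall fun y => ?_)
        by_contra hy
        have hy1 := left_ne_zero_of_smul hy
        have hy2 := right_ne_zero_of_smul hy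
        refine hx ⟨(y, G.mul (-y) x), ⟨subset_tsupport _ hy2, ?_⟩, G.mul_neg_cancel_left y x⟩
        rw [mem_closedBall_zero_iff]
        exact (hw2 _ hy1).le
    refine (eLpNorm_mono_real h1).trans ?_
    rw [eLpNorm_indicator_const hK.measurableSet two_ne_zero (by simp)]
    have h2 : (volume K) ^ (1 / (2 : ENNReal).toReal) = ENNReal.ofReal b := by
      rw [hb, ← ENNReal.ofReal_rpow_of_nonneg measureReal_nonneg (by norm_num), Measure.real,
        ENNReal.ofReal_toReal hK.measure_lt_top.ne]
      simp
    rw [h2, Real.enorm_of_nonneg hd.le, ← ENNReal.ofReal_mul hd.le]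
    rw [← ENNReal.ofReal_coe_nnreal]
    apply ENNReal.ofReal_le_ofReal
    rw [div_mul_eq_mul_div, div_le_iff₀ (by positivity)]
    have : (0 : ℝ) < δ' := hδ'0
    nlinarith
  filter_upwards [hgu, self_mem_nhdsWithin] with w hw hw0
  have hw0 : 0 < w := hw0
  have hwc := G.continuous_rescale hkc w
  have hws := G.hasCompactSupport_rescale hk.hasCompactSupport hw0
  have h1 : G.conv f (G.rescale k w) - f
      = G.conv (f - g) (G.rescale k w) + (G.conv g (G.rescale k w) - g) - (f - g) := by
    rw [G.conv_sub hf hgL hwc hws]; abel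
  have m1 := G.memLp_conv (hf.sub hgL) hwc hws
  have m2 := (G.memLp_conv hgL hwc hws).sub hgL
  calc eLpNorm (G.conv f (G.rescale k w) - f) 2 volume
      ≤ eLpNorm (G.conv (f - g) (G.rescale k w)) 2 volume
        + eLpNorm (G.conv g (G.rescale k w) - g) 2 volume + eLpNorm (f - g) 2 volume := by
        rw [h1]
        refine (eLpNorm_sub_le (m1.1.add m2.1) (hf.sub hgL).1 one_le_two).trans ?_
        gcongr
        exact eLpNorm_add_le m1.1 m2.1 one_le_two
    _ ≤ C * δ' + δ' + δ' := by
        gcongr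
        refine (G.eLpNorm_conv_le (hf.sub hgL).1 hwc).trans ?_
        rw [G.lintegral_enorm_rescale hkc hk.hasCompactSupport hw0]
        gcongr
    _ = (C + 2) * δ' := by ring
    _ ≤ δ := hδ'

end GradedLieGroup

/-! ### Test functions and the self-adjoint extension -/

/-- The space of test functions `C_c^∞`. -/
def testFunctions (n : ℕ) : Submodule ℂ ((Fin n → ℝ) → ℂ) where
  carrier := {f | ContDiff ℝ ∞ f ∧ HasCompactSupport f}
  add_mem' hf hg := ⟨hf.1.add hg.1, hf.2.add hg.2⟩
  zero_mem' := ⟨contDiff_const, HasCompactSupport.zero⟩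
  smul_mem' _ _ hf := ⟨contDiff_const.smul hf.1, hf.2.smul_left⟩

namespace testFunctions

variable {n : ℕ}

theorem memLp (f : testFunctions n) : MemLp f.1 2 volume :=
  f.2.1.continuous.memLp_of_hasCompactSupport f.2.2

/-- The embedding of the test functions into `L²`. -/
noncomputable def toL2 (n : ℕ) : testFunctions n →ₗ[ℂ] GradedLieGroup.L2 n where
  toFun f := (memLp f).toLp
  map_add' f g := MemLp.toLp_add (memLp f) (memLp g)
  map_smul' c f := MemLp.toLp_const_smul c (memLp f)

theorem coeFn_toL2 (f : testFunctions n) : toL2 n f =ᵐ[volume] f.1 := (memLp f).coeFn_toLp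

theorem denseRange_toL2 : DenseRange (toL2 n) := by
  refine (Lp.dense_hasCompactSupport_contDiff (F := ℂ) (μ := (volume : Measure (Fin n → ℝ)))
    (p := 2) (by simp)).mono ?_
  rintro f ⟨g, hfg, hg1, hg2⟩
  refine ⟨⟨g, hg2, hg1⟩, ?_⟩
  ext1
  exact (coeFn_toL2 _).trans hfg.symm

theorem inner_toL2 (f g : testFunctions n) :
    inner ℂ (toL2 n f) (toL2 n g) = ∫ x, g.1 x * starRingEnd ℂ (f.1 x) := by
  rw [L2.inner_def]
  refine integral_congr_ae ?_
  filter_upwards [coeFn_toL2 f, coeFn_toL2 g] with x hf hg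
  rw [hf, hg, RCLike.inner_apply]

end testFunctions

namespace GradedLieGroup

variable {n : ℕ} (G : GradedLieGroup n)

theorem contDiff_comp_mul_smul {f : (Fin n → ℝ) → ℂ} (hf : ContDiff ℝ ∞ f) (j : Fin n) :
    ContDiff ℝ ∞ fun p : (Fin n → ℝ) × ℝ => f (G.mul p.1 (p.2 • Pi.single j 1)) := by
  have h : ContDiff ℝ ∞ fun p : (Fin n → ℝ) × ℝ =>
      (p.1, p.2 • (Pi.single j 1 : Fin n → ℝ)) := by fun_prop
  exact hf.comp (G.contDiff_mul.comp h)

theorem contDiff_vectorField {f : (Fin n → ℝ) → ℂ} (hf : ContDiff ℝ ∞ f) (j : Fin n) :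
    ContDiff ℝ ∞ (G.vectorField j f) := by
  have h0 : ContDiff ℝ ∞ (Function.uncurry
      fun (x : Fin n → ℝ) (t : ℝ) => f (G.mul x (t • Pi.single j 1))) :=
    G.contDiff_comp_mul_smul hf j
  have h := ContDiff.fderiv (n := ∞) (g := fun _ : Fin n → ℝ => (0 : ℝ)) h0 contDiff_const le_rfl
  exact h.clm_apply (contDiff_const (c := (1 : ℝ)))

theorem differentiableAt_comp_mul_smul {f : (Fin n → ℝ) → ℂ} (hf : ContDiff ℝ ∞ f) (j : Fin n)
    (x : Fin n → ℝ) : DifferentiableAt ℝ (fun t : ℝ => f (G.mul x (t • Pi.single j 1))) 0 := by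
  have h : ContDiff ℝ ∞ fun t : ℝ => (x, t) := by fun_prop
  exact ((G.contDiff_comp_mul_smul hf j).comp h).differentiable (by simp) 0

theorem hasCompactSupport_vectorField {f : (Fin n → ℝ) → ℂ} (hf : HasCompactSupport f)
    (j : Fin n) : HasCompactSupport (G.vectorField j f) := by
  refine HasCompactSupport.intro hf.isCompact fun x hx => ?_
  have h1 : Continuous fun t : ℝ => G.mul x (t • Pi.single j 1) := by fun_prop
  have h2 : ∀ᶠ t in 𝓝 (0 : ℝ), G.mul x (t • Pi.single j 1) ∈ (tsupport f)ᶜ := by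
    refine h1.continuousAt.eventually_mem ((isClosed_tsupport f).isOpen_compl.mem_nhds ?_)
    simpa [G.mul_zero] using hx
  have h3 : (fun t : ℝ => f (G.mul x (t • Pi.single j 1))) =ᶠ[𝓝 0] fun _ => 0 :=
    h2.mono fun t ht => image_eq_zero_of_notMem_tsupport ht
  rw [vectorField, h3.deriv_eq, deriv_const]

/-- `X_j` as an operator on test functions. -/
noncomputable def vectorFieldLM (j : Fin n) : testFunctions n →ₗ[ℂ] testFunctions n where
  toFun f := ⟨G.vectorField j f.1, G.contDiff_vectorField f.2.1 j,
    G.hasCompactSupport_vectorField f.2.2 j⟩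
  map_add' f g := by
    ext x
    exact deriv_add (G.differentiableAt_comp_mul_smul f.2.1 j x)
      (G.differentiableAt_comp_mul_smul g.2.1 j x)
  map_smul' c f := by
    ext x
    exact deriv_const_smul c (G.differentiableAt_comp_mul_smul f.2.1 j x)

/-- `X^α` as an operator on test functions. -/
noncomputable def monomialLM (α : Fin n → ℕ) : testFunctions n →ₗ[ℂ] testFunctions n :=
  ((List.finRange n).map fun j => G.vectorFieldLM j ^ α j).prod

theorem coe_monomialLM (α : Fin n → ℕ) (f : testFunctions n) :
    (G.monomialLM α f : (Fin n → ℝ) → ℂ) = G.monomial α f := by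
  have hpow : ∀ (j : Fin n) (m : ℕ) (g : testFunctions n),
      ((G.vectorFieldLM j ^ m) g : (Fin n → ℝ) → ℂ) = (G.vectorField j)^[m] g := by
    intro j m
    induction m with
    | zero => intro g; rfl
    | succ m ih =>
      intro g
      rw [pow_succ, Module.End.mul_apply, ih, Function.iterate_succ_apply]
      rfl
  unfold monomialLM monomial
  induction List.finRange n with
  | nil => rfl
  | cons j l ih => rw [List.map_cons, List.prod_cons, Module.End.mul_apply, hpow, ih,
      List.foldr_cons]

/-- `∑_α c_α X^α` as an operator on test functions. -/
noncomputable def diffOpLM (c : (Fin n → ℕ) →₀ ℂ) : testFunctions n →ₗ[ℂ] testFunctions n :=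
  c.sum fun α a => a • G.monomialLM α

theorem coe_diffOpLM (c : (Fin n → ℕ) →₀ ℂ) (f : testFunctions n) :
    (G.diffOpLM c f : (Fin n → ℝ) → ℂ) = G.diffOp c f := by
  ext x
  simp only [diffOpLM, diffOp, Finsupp.sum, LinearMap.sum_apply, Submodule.coe_sum,
    Finset.sum_apply, LinearMap.smul_apply, Submodule.coe_smul, Pi.smul_apply, smul_eq_mul,
    coe_monomialLM]

theorem exists_isSelfAdjointExtension {c : (Fin n → ℕ) →₀ ℂ}
    (hpos : ∀ f : (Fin n → ℝ) → ℂ, ContDiff ℝ ∞ f → HasCompactSupport f →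
      (∫ x, G.diffOp c f x * starRingEnd ℂ (f x)).im = 0 ∧
        0 ≤ (∫ x, G.diffOp c f x * starRingEnd ℂ (f x)).re) :
    ∃ A, G.IsSelfAdjointExtension c A := by
  -- The inner product is conjugate-linear in its first argument, hence the conjugate; the sign
  -- conditions are unaffected.
  have hin : ∀ f : testFunctions n,
      inner ℂ ((testFunctions.toL2 n ∘ₗ G.diffOpLM c) f) (testFunctions.toL2 n f)
        = starRingEnd ℂ (∫ x, G.diffOp c f x * starRingEnd ℂ (f.1 x)) := fun f => by
    rw [← inner_conj_symm, LinearMap.comp_apply, testFunctions.inner_toL2, coe_diffOpLM]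
  obtain ⟨A, hA, hA0, hgr⟩ := exists_friedrichs_extension (testFunctions.toL2 n)
    (testFunctions.toL2 n ∘ₗ G.diffOpLM c) testFunctions.denseRange_toL2
    (fun f => by rw [hin, Complex.conj_im, (hpos f.1 f.2.1 f.2.2).1, neg_zero])
    (fun f => by rw [hin, Complex.conj_re]; exact (hpos f.1 f.2.1 f.2.2).2)
  refine ⟨A, hA, hA0, fun f hf hc => ?_⟩
  refine ⟨_, _, testFunctions.coeFn_toL2 ⟨f, hf, hc⟩, ?_, hgr ⟨f, hf, hc⟩⟩
  have h := testFunctions.coeFn_toL2 (G.diffOpLM c ⟨f, hf, hc⟩)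
  rwa [coe_diffOpLM] at h

end GradedLieGroup

/-! ### Multiplication operators -/

section Multiplication

variable {n : ℕ}

/-- Multiplication by a bounded real function, as an operator on `L²`. -/
theorem exists_mulCLM {W : (Fin n → ℝ) → ℝ} (hWm : AEStronglyMeasurable W volume) {M : ℝ}
    (hM : 0 ≤ M) (hW : ∀ x, ‖W x‖ ≤ M) :
    ∃ B : GradedLieGroup.L2 n →L[ℂ] GradedLieGroup.L2 n,
      (∀ u, B u =ᵐ[volume] fun x => (W x : ℂ) * u x) ∧
      (∀ u v, inner ℂ (B u) v = inner ℂ u (B v)) ∧ ‖B‖ ≤ M := by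
  have hle : ∀ (u : GradedLieGroup.L2 n) x, ‖(W x : ℂ) * u x‖ ≤ M * ‖u x‖ := fun u x => by
    rw [norm_mul, Complex.norm_real]
    gcongr
    exact hW x
  have hmem : ∀ u : GradedLieGroup.L2 n, MemLp (fun x => (W x : ℂ) * u x) 2 volume := fun u =>
    (Lp.memLp u).of_le_mul
      ((Complex.continuous_ofReal.comp_aestronglyMeasurable hWm).mul (Lp.memLp u).1)
      (Eventually.of_forall (hle u))
  let B : GradedLieGroup.L2 n →ₗ[ℂ] GradedLieGroup.L2 n :=
    { toFun := fun u => (hmem u).toLp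
      map_add' := fun u v => by
        ext1
        filter_upwards [(hmem (u + v)).coeFn_toLp, (hmem u).coeFn_toLp, (hmem v).coeFn_toLp,
          Lp.coeFn_add u v, Lp.coeFn_add (hmem u).toLp (hmem v).toLp] with x h1 h2 h3 h4 h5
        rw [h1, h5, Pi.add_apply, h2, h3, h4, Pi.add_apply, mul_add]
      map_smul' := fun r u => by
        ext1
        filter_upwards [(hmem (r • u)).coeFn_toLp, (hmem u).coeFn_toLp,
          Lp.coeFn_smul r u, Lp.coeFn_smul r (hmem u).toLp] with x h1 h2 h3 h4
        rw [h1, RingHom.id_apply, h4, Pi.smul_apply, h2, h3, Pi.smul_apply, smul_eq_mul, smul_eq_mul]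
        ring }
  have hB : ∀ u, B u =ᵐ[volume] fun x => (W x : ℂ) * u x := fun u => (hmem u).coeFn_toLp
  have hBn : ∀ u, ‖B u‖ ≤ M * ‖u‖ := fun u => by
    refine Lp.norm_le_mul_norm_of_ae_le_mul ?_
    filter_upwards [hB u] with x hx
    rw [hx]
    exact hle u x
  refine ⟨B.mkContinuous M hBn, hB, fun u v => ?_, LinearMap.mkContinuous_norm_le _ hM _⟩
  rw [L2.inner_def, L2.inner_def]
  refine integral_congr_ae ?_
  filter_upwards [hB u, hB v] with x h1 h2
  simp only [LinearMap.mkContinuous_apply]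
  rw [h1, h2, RCLike.inner_apply, RCLike.inner_apply, map_mul, Complex.conj_ofReal]
  ring

end Multiplication

/-! ### Energy estimates and well-posedness of the Cauchy problem -/

section HeatSolution

variable {n : ℕ} {A : GradedLieGroup.L2 n →ₗ.[ℂ] GradedLieGroup.L2 n}

theorem graph_inner_nonneg (hA0 : ∀ v : A.domain, 0 ≤ (inner ℂ (A v) (v : GradedLieGroup.L2 n)).re)
    {x y : GradedLieGroup.L2 n} (h : (x, y) ∈ A.graph) : 0 ≤ (inner ℂ y x).re := by
  obtain ⟨z, rfl, rfl⟩ := (LinearPMap.mem_graph_iff A).1 h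
  exact hA0 z

/-- In terms of the multiplication operator `B = W`, a solution satisfies `u' = -(A u + B u)`. -/
theorem IsHeatSolution.hasDerivWithinAt {W : (Fin n → ℝ) → ℝ} {g : (Fin n → ℝ) → ℂ} {T : ℝ}
    {u : ℝ → GradedLieGroup.L2 n} (hu : IsHeatSolution A W g T u)
    {B : GradedLieGroup.L2 n →L[ℂ] GradedLieGroup.L2 n}
    (hB : ∀ u, B u =ᵐ[volume] fun x => (W x : ℂ) * u x) {t : ℝ} (ht : t ∈ Ioc 0 T) :
    ∃ v, (u t, v) ∈ A.graph ∧ HasDerivWithinAt u (-(v + B (u t))) (Icc 0 T) t := by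
  obtain ⟨v, w, hv, hw, hd⟩ := hu.2.2 t ht
  have : w = B (u t) := by
    ext1
    exact hw.trans (hB (u t)).symm
  exact ⟨v, hv, this ▸ hd⟩

/-- Stability of the Cauchy problem under perturbation of the potential and of the data. -/
theorem IsHeatSolution.norm_sub_sq_le
    (hA0 : ∀ v : A.domain, 0 ≤ (inner ℂ (A v) (v : GradedLieGroup.L2 n)).re)
    {W₁ W₂ : (Fin n → ℝ) → ℝ} {g₁ g₂ : (Fin n → ℝ) → ℂ} {T M δ K : ℝ} (hM : 0 ≤ M) (hδ : 0 ≤ δ)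
    (hm₁ : AEStronglyMeasurable W₁ volume) (hW₁ : ∀ x, ‖W₁ x‖ ≤ M)
    (hm₂ : AEStronglyMeasurable W₂ volume) (hW₂ : ∀ x, ‖W₂ x‖ ≤ M)
    (hW : ∀ x, ‖W₁ x - W₂ x‖ ≤ δ) {u₁ u₂ : ℝ → GradedLieGroup.L2 n}
    (h₁ : IsHeatSolution A W₁ g₁ T u₁) (h₂ : IsHeatSolution A W₂ g₂ T u₂)
    (hK : ∀ t ∈ Icc 0 T, ‖u₂ t‖ ≤ K) {t : ℝ} (ht : t ∈ Icc 0 T) :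
    ‖u₁ t - u₂ t‖ ^ 2 ≤ Real.exp ((2 * M + 1) * t) * (‖u₁ 0 - u₂ 0‖ ^ 2 + (δ * K) ^ 2) := by
  obtain ⟨B₁, hB₁, -, hn₁⟩ := exists_mulCLM hm₁ hM hW₁
  obtain ⟨B₂, hB₂, -, -⟩ := exists_mulCLM hm₂ hM hW₂
  have hdiff : ∀ u, ‖B₁ u - B₂ u‖ ≤ δ * ‖u‖ := fun u => by
    refine Lp.norm_le_mul_norm_of_ae_le_mul ?_
    filter_upwards [Lp.coeFn_sub (B₁ u) (B₂ u), hB₁ u, hB₂ u] with x e1 e2 e3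
    rw [e1, Pi.sub_apply, e2, e3, ← sub_mul, ← Complex.ofReal_sub, norm_mul, Complex.norm_real]
    gcongr
    exact hW x
  have key := norm_sq_add_le_of_hasDerivWithinAt (w := fun t => u₁ t - u₂ t) (T := T)
    (C := 2 * M + 1) (b := (δ * K) ^ 2) (h₁.1.sub h₂.1) (fun t ht => ?_) ht
  · have : 0 ≤ (δ * K) ^ 2 := sq_nonneg _
    linarith
  · obtain ⟨v₁, hv₁, hd₁⟩ := h₁.hasDerivWithinAt hB₁ ht
    obtain ⟨v₂, hv₂, hd₂⟩ := h₂.hasDerivWithinAt hB₂ ht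
    refine ⟨_, hd₁.sub hd₂, ?_⟩
    set w := u₁ t - u₂ t with hw
    -- The difference of the potentials is made to act on `u₂`, so only `u₂` needs an a priori
    -- bound; the part in `A` is dissipative.
    have e1 : -(v₁ + B₁ (u₁ t)) - -(v₂ + B₂ (u₂ t))
        = -(v₁ - v₂) - (B₁ w + (B₁ (u₂ t) - B₂ (u₂ t))) := by
      rw [hw, map_sub]; abel
    have e2 : 0 ≤ (inner ℂ w (v₁ - v₂)).re := by
      have := graph_inner_nonneg hA0 (A.graph.sub_mem hv₁ hv₂)
      rw [← inner_conj_symm, Complex.conj_re]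
      exact this
    have e3 : ‖B₁ w + (B₁ (u₂ t) - B₂ (u₂ t))‖ ≤ M * ‖w‖ + δ * K := by
      refine (norm_add_le _ _).trans (add_le_add (B₁.le_of_opNorm_le hn₁ w) ?_)
      refine (hdiff _).trans ?_
      gcongr
      exact hK t ⟨ht.1.le, ht.2⟩
    have e4 := (abs_le.1 ((Complex.abs_re_le_norm _).trans
      (norm_inner_le_norm (𝕜 := ℂ) w (B₁ w + (B₁ (u₂ t) - B₂ (u₂ t)))))).1
    have e5 : ‖w‖ * ‖B₁ w + (B₁ (u₂ t) - B₂ (u₂ t))‖ ≤ ‖w‖ * (M * ‖w‖ + δ * K) := by gcongr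
    rw [e1, inner_sub_right, inner_neg_right, Complex.sub_re, Complex.neg_re]
    -- `2 ‖w‖ δK ≤ ‖w‖² + (δK)²` accounts for the `+ 1` in `2M + 1` and for the constant `b =
    -- (δK)²`.
    nlinarith [sq_nonneg (‖w‖ - δ * K), mul_nonneg hM (sq_nonneg (δ * K)), sq_nonneg (δ * K)]

/-- The energy estimate is run directly with `b = 0`: comparison with the zero solution through
`IsHeatSolution.norm_sub_sq_le` would give the weaker rate `M + 1/2`. -/
theorem IsHeatSolution.norm_le
    (hA0 : ∀ v : A.domain, 0 ≤ (inner ℂ (A v) (v : GradedLieGroup.L2 n)).re)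
    {W : (Fin n → ℝ) → ℝ} {g : (Fin n → ℝ) → ℂ} {T M : ℝ} (hM : 0 ≤ M)
    (hm : AEStronglyMeasurable W volume) (hW : ∀ x, ‖W x‖ ≤ M) {u : ℝ → GradedLieGroup.L2 n}
    (h : IsHeatSolution A W g T u) {t : ℝ} (ht : t ∈ Icc 0 T) :
    ‖u t‖ ≤ Real.exp (t * M) * ‖u 0‖ := by
  obtain ⟨B, hB, -, hn⟩ := exists_mulCLM hm hM hW
  have key := norm_sq_add_le_of_hasDerivWithinAt (T := T) (C := 2 * M) (b := 0) h.1
    (fun t ht => ?_) ht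
  · rw [← sq_le_sq₀ (norm_nonneg _) (by positivity), mul_pow, ← Real.exp_nat_mul]
    simp only [add_zero] at key
    convert! key using 3
    push_cast
    ring
  · obtain ⟨v, hv, hd⟩ := h.hasDerivWithinAt hB ht
    refine ⟨_, hd, ?_⟩
    have e2 : 0 ≤ (inner ℂ (u t) v).re := by
      rw [← inner_conj_symm, Complex.conj_re]
      exact graph_inner_nonneg hA0 hv
    have e4 := (abs_le.1 ((Complex.abs_re_le_norm _).trans
      (norm_inner_le_norm (𝕜 := ℂ) (u t) (B (u t))))).1
    have e5 : ‖u t‖ * ‖B (u t)‖ ≤ ‖u t‖ * (M * ‖u t‖) := by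
      gcongr
      exact B.le_of_opNorm_le hn _
    rw [inner_neg_right, inner_add_right, Complex.neg_re, Complex.add_re]
    nlinarith

/-- Well-posedness of the Cauchy problem, for a bounded measurable potential and data in `L²`. -/
theorem exists_isUniqueHeatSolution (hA : IsSelfAdjoint A)
    (hA0 : ∀ v : A.domain, 0 ≤ (inner ℂ (A v) (v : GradedLieGroup.L2 n)).re)
    {W : (Fin n → ℝ) → ℝ} {M : ℝ} (hM : 0 ≤ M) (hm : AEStronglyMeasurable W volume)
    (hW : ∀ x, ‖W x‖ ≤ M) {g : (Fin n → ℝ) → ℂ} (hg : MemLp g 2 volume) (T : ℝ) :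
    ∃ u, IsUniqueHeatSolution A W g T u := by
  obtain ⟨B, hB, hBs, -⟩ := exists_mulCLM hm hM hW
  obtain ⟨u, hu, hu0, hut⟩ := exists_heat_solution hA
    (fun x y hxy => graph_inner_nonneg hA0 hxy) B hBs hg.toLp
  have hsol : IsHeatSolution A W g T u := by
    refine ⟨hu.mono Icc_subset_Ici_self, hu0 ▸ hg.coeFn_toLp, fun t ht => ?_⟩
    obtain ⟨v, hv, hd⟩ := hut t ht.1
    exact ⟨v, B (u t), hv, hB (u t), hd.hasDerivWithinAt⟩
  refine ⟨u, hsol, fun u' hu' t ht => ?_⟩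
  obtain ⟨K, hK⟩ := (isCompact_Icc.image_of_continuousOn hsol.1).isBounded.exists_norm_le
  -- Uniqueness is stability with equal potentials, `δ = 0`; a bound `K` for `u` exists by
  -- compactness of `[0, T]`.
  have h := hu'.norm_sub_sq_le hA0 hM le_rfl hm hW hm hW (fun x => by simp) hsol
    (K := K) (fun t ht => hK _ (mem_image_of_mem u ht)) ht
  have h0 : u' 0 = u 0 := by
    ext1
    exact hu'.2.1.trans hsol.2.1.symm
  rw [h0, sub_self, norm_zero] at h
  simp only [ne_eq, OfNat.ofNat_ne_zero, not_false_eq_true, zero_pow, zero_mul, add_zero,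
    mul_zero] at h
  have h1 : ‖u' t - u t‖ = 0 := by
    have := sq_nonneg ‖u' t - u t‖
    exact pow_eq_zero_iff two_ne_zero |>.1 (le_antisymm h this)
  exact sub_eq_zero.1 (norm_eq_zero.1 h1)

end HeatSolution

/-! ### Convergence of the regularised solutions -/

theorem IsScale.tendsto_nhdsGT {ρ : ℝ → ℝ} (hρ : IsScale ρ) : Tendsto ρ (𝓝[>] 0) (𝓝[>] 0) := by
  refine tendsto_nhdsWithin_iff.2 ⟨hρ.tendsto, ?_⟩
  filter_upwards [Ioc_mem_nhdsGT one_pos] with ε hε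
  exact hρ.pos ε hε

theorem mainTheorem7 {n : ℕ} (G : GradedLieGroup n) (c : (Fin n → ℕ) →₀ ℂ) (ν : ℕ)
    (hR : G.IsPositiveRockland c ν) (T : ℝ) (hT : 0 < T)
    (V : C₀(Fin n → ℝ, ℝ)) (u₀ : GradedLieGroup.L2 n)
    (ψ φ : (Fin n → ℝ) → ℝ) (hψ : IsMollifier ψ) (hφ : IsMollifier φ)
    (ρ η : ℝ → ℝ) (hρ : IsScale ρ) (hη : IsScale η) :
    (∃ A, G.IsSelfAdjointExtension c A) ∧
    ∀ A, G.IsSelfAdjointExtension c A →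
      ∃ (u : ℝ → GradedLieGroup.L2 n) (uε : ℝ → ℝ → GradedLieGroup.L2 n),
        IsUniqueHeatSolution A V u₀ T u ∧
        (∀ t ∈ Icc 0 T, ‖u t‖ ≤ Real.exp (t * ‖V‖) * ‖u₀‖) ∧
        (∀ ε ∈ Ioc (0 : ℝ) 1,
          IsUniqueHeatSolution A (G.conv V (G.rescale ψ (ρ ε))) (G.conv u₀ (G.rescale φ (η ε))) T
            (uε ε)) ∧
        TendstoUniformlyOn uε u (𝓝[>] 0) (Icc 0 T) := by
  refine ⟨G.exists_isSelfAdjointExtension hR.positive, fun A hA => ?_⟩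
  have hA0 := hA.nonneg
  have hVc : Continuous V := V.continuous
  have hVm : AEStronglyMeasurable V volume := hVc.aestronglyMeasurable
  have hVn : ∀ x, ‖V x‖ ≤ ‖V‖ := fun x => V.toBCF.norm_coe_le_norm x
  have hψc := hψ.contDiff.continuous
  have hφc := hφ.contDiff.continuous
  set I := ∫ x, ‖ψ x‖ with hI
  have hI0 : 0 ≤ I := integral_nonneg fun _ => norm_nonneg _
  have hVεm : ∀ ε, AEStronglyMeasurable (G.conv V (G.rescale ψ (ρ ε))) volume := fun ε =>
    G.aestronglyMeasurable_conv hVm (G.continuous_rescale hψc _)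
  -- The bound `‖ψ‖₁ ‖V‖` does not depend on `ε`, so the Gronwall constant below is uniform.
  have hVεn : ∀ ε ∈ Ioc (0 : ℝ) 1, ∀ x, ‖G.conv V (G.rescale ψ (ρ ε)) x‖ ≤ I * ‖V‖ := by
    intro ε hε x
    have h := G.norm_conv_le hVn (G.continuous_rescale hψc (ρ ε))
      (G.hasCompactSupport_rescale hψ.hasCompactSupport (hρ.pos ε hε)) x
    simp only [G.norm_rescale ψ (hρ.pos ε hε)] at h
    rwa [G.integral_rescale hψc.norm (hρ.pos ε hε)] at h
  have hgε : ∀ ε ∈ Ioc (0 : ℝ) 1, MemLp (G.conv u₀ (G.rescale φ (η ε))) 2 volume := fun ε hε =>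
    G.memLp_conv (Lp.memLp u₀) (G.continuous_rescale hφc _)
      (G.hasCompactSupport_rescale hφ.hasCompactSupport (hη.pos ε hε))
  obtain ⟨u, hu⟩ := exists_isUniqueHeatSolution hA.isSelfAdjoint hA0 (norm_nonneg V) hVm hVn
    (Lp.memLp u₀) T
  have hex : ∀ ε ∈ Ioc (0 : ℝ) 1, ∃ v, IsUniqueHeatSolution A (G.conv V (G.rescale ψ (ρ ε)))
      (G.conv u₀ (G.rescale φ (η ε))) T v := fun ε hε =>
    exists_isUniqueHeatSolution hA.isSelfAdjoint hA0 (by positivity) (hVεm ε) (hVεn ε hε)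
      (hgε ε hε) T
  choose! uε huε using hex
  have hu0 : u 0 = u₀ := by
    ext1
    exact hu.1.2.1
  have hun : ∀ t ∈ Icc 0 T, ‖u t‖ ≤ Real.exp (t * ‖V‖) * ‖u₀‖ := fun t ht => by
    have h := hu.1.norm_le hA0 (norm_nonneg V) hVm hVn ht
    rwa [hu0] at h
  refine ⟨u, uε, hu, hun, huε, ?_⟩
  set M := max ‖V‖ (I * ‖V‖) with hM
  have hM0 : 0 ≤ M := (norm_nonneg V).trans (le_max_left _ _)
  set K := Real.exp (T * ‖V‖) * ‖u₀‖ with hK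
  have huK : ∀ t ∈ Icc 0 T, ‖u t‖ ≤ K := fun t ht => (hun t ht).trans (by
    rw [hK]
    gcongr
    exact ht.2)
  rw [Metric.tendstoUniformlyOn_iff]
  intro r hr
  -- If potentials and data are both within `δ`, stability bounds the squared error by `D δ²`; the
  -- choice `δ = r / (D + 1)` makes this less than `r²`.
  set D := Real.exp ((2 * M + 1) * T) * (1 + K ^ 2) with hD
  have hD0 : 0 ≤ D := by positivity
  set δ := r / (D + 1) with hδ
  have hδ0 : 0 < δ := by positivity
  have ev1 := hρ.tendsto_nhdsGT.eventually
    (G.eventually_norm_conv_rescale_sub_le hVc (zero_at_infty V) hψ hδ0)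
  have ev2 := hη.tendsto_nhdsGT.eventually
    (G.eventually_eLpNorm_conv_rescale_sub_le (Lp.memLp u₀) hφ (ENNReal.ofReal_pos.2 hδ0))
  filter_upwards [ev1, ev2, Ioc_mem_nhdsGT one_pos] with ε h1 h2 hε t ht
  have h3 : ‖uε ε 0 - u 0‖ ≤ δ := by
    rw [Lp.norm_def]
    refine ENNReal.toReal_le_of_le_ofReal hδ0.le (le_of_eq_of_le (eLpNorm_congr_ae ?_) h2)
    exact (Lp.coeFn_sub _ _).trans ((huε ε hε).1.2.1.sub hu.1.2.1)
  have h4 := (huε ε hε).1.norm_sub_sq_le hA0 hM0 hδ0.le (hVεm ε)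
    (fun x => (hVεn ε hε x).trans (le_max_right _ _)) hVm
    (fun x => (hVn x).trans (le_max_left _ _)) h1 hu.1 huK ht
  rw [dist_comm, dist_eq_norm, ← sq_lt_sq₀ (norm_nonneg _) hr.le]
  calc ‖uε ε t - u t‖ ^ 2
      ≤ Real.exp ((2 * M + 1) * t) * (‖uε ε 0 - u 0‖ ^ 2 + (δ * K) ^ 2) := h4
    _ ≤ Real.exp ((2 * M + 1) * T) * (δ ^ 2 + (δ * K) ^ 2) := by
        gcongr
        exact ht.2
    _ = D * δ ^ 2 := by rw [hD]; ring
    _ < (D + 1) ^ 2 * δ ^ 2 := by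
        gcongr
        nlinarith
    _ = r ^ 2 := by rw [hδ]; field_simp
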